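/- **Setting.** Work in a Martin-Löf type theory with a cumulative hierarchy $\mathrm{Set}_k$, $\Pi$-types, $\Sigma$-types, a unit type, a universe of finite enumerations of tags, and universes of codes for strictly positive inductive types and inductive families, with their fixpoints and induction principles. Contexts consist of declarations $x:S$ and definitions $x\mapsto t:S$. The judgments are $\Gamma\vdash\mathrm{VALID}$, $\Gamma\vdash t:T$ and $\Gamma\vdash s\equiv t:T$. Equality is the congruence generated by the computation rules and the unfolding of definitions. A context is valid if it is empty, or if it extends a valid context by a fresh variable with a well-formed type and, for a definition, a body of that type. *Programming labels.* If $\Gamma$ is valid, every name $\mathbf f$ is a label in $\Gamma$. If $l$ is a label and $\Gamma\vdash t:T$, then $l\,t$ is a label. If $l$ is a label and $\Gamma\vdash T:\mathrm{Set}_k$, then $\Gamma\vdash\langle l:T\rangle:\mathrm{Set}_k$. If $\Gamma\vdash t:T$ and $l$ is a label, then $\Gamma\vdash\mathsf{return}\,t:\langle l:T\rangle$. If $\Gamma\vdash c:\langle l:T\rangle$, then $\Gamma\vdash\mathsf{call}\langle l:T\rangle\,c:T$. Moreover $\mathsf{call}\langle l:T\rangle(\mathsf{return}\,t)\equiv t$.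 *Elaboration of terms.* External terms elaborate to internal terms through a bidirectional type checker. Its judgments are type synthesis ($e$ elaborates to $t'$ with type $T$ in $\Gamma$) and type checking ($e$, checked against $T$ in $\Gamma$, elaborates to $t'$). External terms include unannotated abstractions, tuples, finite sets of tags and their case analysis, tags as indices, datatype constructors, and labels. The axioms of the type checker apply in valid contexts. *Elaboration of program bodies.* Fix an arbitrary relation $l\lhd pt$ between labels and patterns. Fix also a relation "the elimination form $e$ yields $e'$ of type $T$ in $\Gamma$", assumed only to be such that then $\Gamma\vdash e':T$. The relation "in $\Gamma$, the program body $p$ realizes $\langle l:T\rangle$ by $t'$" is generated by two rules. * (Return) If $l\lhd pt$ and $e$, checked against $T$ in $\Gamma$, elaborates to $e'$, then $pt\mapsto e$ realizes $\langle l:T\rangle$ by $\mathsf{return}\,e'$. * (By) Suppose $l\lhd pt$, and $e$ yields $e'$ of type $(\vec x_1:\vec X_1\to\langle l_1:S_1\rangle)\to\dots\to(\vec x_n:\vec X_n\to\langle l_n:S_n\rangle)\to\langle l:T\rangle$ in $\Gamma$. Suppose also that for each $i$, in $\Gamma,\vec x_i:\vec X_i$, the body $p_i$ realizes $\langle l_i:S_i\rangle$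 by $s_i$. Then $pt\Leftarrow e\,\{p_1,\dots,p_n\}$ realizes $\langle l:T\rangle$ by $e'\,(\lambda\vec x_1:\vec X_1.\,s_1)\cdots(\lambda\vec x_n:\vec X_n.\,s_n)$. *Elaboration of declarations.* Suppose $(\vec x:\vec X)\to T$, checked against some $\mathrm{Set}_k$ in $\Gamma$, elaborates to $(\vec x:\vec X')\to T'$. Suppose also that in $\Gamma,\vec x:\vec X'$ the body $t$ realizes $\langle\mathbf f\,\vec x:T'\rangle$ by $t'$. Then the declaration $\mathsf{let}\ f\,(\vec x:\vec X):T$ with body $t$ elaborates in $\Gamma$ to the context $$\Gamma,\; f\mapsto\lambda\vec x:\vec X'.\ \mathsf{call}\langle\mathbf f\,\vec x:T'\rangle\,t' \;:\; (\vec x:\vec X')\to T',$$ where $f$ is fresh for $\Gamma$. **Theorem (Soundness of program elaboration).** If in the context $\Gamma$ the program declaration $\mathsf{let}\ f\,(\vec x:\vec X):T$ with body $t$ elaborates to the context $\Delta$, then $\Delta$ is a valid context. -/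

import Mathlib

/-!
The type theory, its external language and the elaboration of programs.

Binding is represented by de Bruijn indices throughout (internal terms, external terms and
contexts), so that a context is always extended by a fresh variable.  Names (`String`) are only
used for tags and for the heads of programming labels.
-/
namespace LabelTT

/-! ### Internal terms -/

/-- The constants of the three universes: enumerations, inductive types and inductive families.
`Set` is typically ambiguous, hence the universe levels `k` (size of the codes) and `j` (level of
the motive). -/
inductive Const : Type
  -- tags and enumerations
  | uid | tag (s : String)
  | enumU | nilE | consE
  | enumT | zeE | suE
  | spi (k : ℕ) | switch (k : ℕ)
  -- universe of inductive types
  | desc (k : ℕ) | dVar (k : ℕ) | dUnit (k : ℕ) | dTimes (k : ℕ)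
  | dPi (k : ℕ) | dSigma (k : ℕ) | dsigma (k : ℕ)
  | interp (k : ℕ) | mu (k : ℕ) | con (k : ℕ)
  | dAll (k j : ℕ) | dEvery (k j : ℕ) | dInd (k j : ℕ)
  -- universe of inductive families
  | idesc (k : ℕ) | iVar (k : ℕ) | iUnit (k : ℕ) | iTimes (k : ℕ)
  | iPi (k : ℕ) | iSigma (k : ℕ) | isigma (k : ℕ)
  | iInterp (k : ℕ) | imu (k : ℕ) | icon (k : ℕ)
  | iAll (k j : ℕ) | iEvery (k j : ℕ) | iInd (k j : ℕ)

/-- Internal terms.  Programming labels `f t₁ … tₙ` are built from `lname` and `lapp`. -/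
inductive Tm : Type
  | var (x : ℕ)
  | set (k : ℕ)
  | pi (S T : Tm)             -- `(x : S) → T`, binds in `T`
  | lam (S t : Tm)            -- `λ x : S. t`, binds in `t`
  | app (f s : Tm)
  | sigma (S T : Tm)          -- `(x : S) × T`, binds in `T`
  | pair (s t T : Tm)         -- `(s, t)` annotated with `x. T`, binds in `T`
  | fst (p : Tm)
  | snd (p : Tm)
  | unit
  | void                      -- the inhabitant of `unit`
  | const (c : Const)
  | lname (f : String)        -- the label `f`
  | lapp (l t : Tm)           -- the label `l t`
  | lbl (l T : Tm)            -- the label type `⟨l : T⟩`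
  | ret (t : Tm)              -- `return t`
  | call (l T c : Tm)         -- `call ⟨l : T⟩ c`

/-- Extension of a renaming under one binder. -/
def liftRen (ξ : ℕ → ℕ) : ℕ → ℕ
  | 0 => 0
  | n + 1 => ξ n + 1

namespace Tm

def rename (ξ : ℕ → ℕ) : Tm → Tm
  | var x => var (ξ x)
  | set k => set k
  | pi S T => pi (S.rename ξ) (T.rename (liftRen ξ))
  | lam S t => lam (S.rename ξ) (t.rename (liftRen ξ))
  | app f s => app (f.rename ξ) (s.rename ξ)
  | sigma S T => sigma (S.rename ξ) (T.rename (liftRen ξ))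
  | pair s t T => pair (s.rename ξ) (t.rename ξ) (T.rename (liftRen ξ))
  | fst p => fst (p.rename ξ)
  | snd p => snd (p.rename ξ)
  | unit => unit
  | void => void
  | const c => const c
  | lname f => lname f
  | lapp l t => lapp (l.rename ξ) (t.rename ξ)
  | lbl l T => lbl (l.rename ξ) (T.rename ξ)
  | ret t => ret (t.rename ξ)
  | call l T c => call (l.rename ξ) (T.rename ξ) (c.rename ξ)

/-- Weakening by one variable. -/
abbrev wk (t : Tm) : Tm := t.rename Nat.succ

/-- Extension of a substitution under one binder. -/
def liftSub (σ : ℕ → Tm) : ℕ → Tm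
  | 0 => var 0
  | n + 1 => (σ n).wk

def subst (σ : ℕ → Tm) : Tm → Tm
  | var x => σ x
  | set k => set k
  | pi S T => pi (S.subst σ) (T.subst (liftSub σ))
  | lam S t => lam (S.subst σ) (t.subst (liftSub σ))
  | app f s => app (f.subst σ) (s.subst σ)
  | sigma S T => sigma (S.subst σ) (T.subst (liftSub σ))
  | pair s t T => pair (s.subst σ) (t.subst σ) (T.subst (liftSub σ))
  | fst p => fst (p.subst σ)
  | snd p => snd (p.subst σ)
  | unit => unit
  | void => void
  | const c => const c
  | lname f => lname f
  | lapp l t => lapp (l.subst σ) (t.subst σ)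
  | lbl l T => lbl (l.subst σ) (T.subst σ)
  | ret t => ret (t.subst σ)
  | call l T c => call (l.subst σ) (T.subst σ) (c.subst σ)

/-- The substitution replacing the last variable by `s`. -/
def single (s : Tm) : ℕ → Tm
  | 0 => s
  | n + 1 => var n

/-- `T[s/x]`, for `x` the last variable of the context of `T`. -/
def inst (T s : Tm) : Tm := T.subst (single s)

/-- Non-dependent function type `S → T`. -/
def arrow (S T : Tm) : Tm := pi S T.wk

/-- Non-dependent product type `S × T`. -/
def prod (S T : Tm) : Tm := sigma S T.wk

/-- The non-dependent pair `(s, t) : S × T`. -/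
def npair (s t T : Tm) : Tm := pair s t T.wk

/-- `f s₁ … sₙ`. -/
def apps (f : Tm) (ss : List Tm) : Tm := ss.foldl app f

/-- `c s₁ … sₙ` for a constant `c`. -/
def cst (c : Const) (ss : List Tm) : Tm := (const c).apps ss

end Tm

open Tm

/-! ### The types of the constants

In each case the comment gives the type with names. -/

/-- The (closed) type of a constant. -/
def Const.type : Const → Tm
  -- `UId : Set`, `'s : UId`
  | uid => set 0
  | tag _ => cst uid []
  -- `EnumU : Set`, `nilE : EnumU`, `consE : UId → EnumU → EnumU`
  | enumU => set 0
  | nilE => cst enumU []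
  | consE => arrow (cst uid []) (arrow (cst enumU []) (cst enumU []))
  -- `EnumT : EnumU → Set`
  | enumT => arrow (cst enumU []) (set 0)
  -- `(t : UId) (E : EnumU) → EnumT (consE t E)`
  | zeE => pi (cst uid []) (pi (cst enumU []) (cst enumT [cst consE [var 1, var 0]]))
  -- `(t : UId) (E : EnumU) → EnumT E → EnumT (consE t E)`
  | suE => pi (cst uid []) (pi (cst enumU [])
      (arrow (cst enumT [var 0]) (cst enumT [cst consE [var 1, var 0]])))
  -- `(E : EnumU) (P : EnumT E → Set) → Set`
  | spi k => pi (cst enumU []) (pi (arrow (cst enumT [var 0]) (set k)) (set k))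
  -- `(E : EnumU) (P : EnumT E → Set) → π E P → (x : EnumT E) → P x`
  | switch k => pi (cst enumU []) (pi (arrow (cst enumT [var 0]) (set k))
      (arrow (cst (spi k) [var 1, var 0]) (pi (cst enumT [var 1]) (app (var 1) (var 0)))))
  -- codes
  | desc k => set (k + 1)
  | dVar k => cst (desc k) []
  | dUnit k => cst (desc k) []
  | dTimes k => arrow (cst (desc k) []) (arrow (cst (desc k) []) (cst (desc k) []))
  -- `(S : Set) (T : S → Desc) → Desc`
  | dPi k => pi (set k) (arrow (arrow (var 0) (cst (desc k) [])) (cst (desc k) []))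
  | dSigma k => pi (set k) (arrow (arrow (var 0) (cst (desc k) [])) (cst (desc k) []))
  -- `(E : EnumU) (T : EnumT E → Desc) → Desc`
  | dsigma k => pi (cst enumU [])
      (arrow (arrow (cst enumT [var 0]) (cst (desc k) [])) (cst (desc k) []))
  -- `Desc → Set → Set`
  | interp k => arrow (cst (desc k) []) (arrow (set k) (set k))
  -- `Desc → Set`
  | mu k => arrow (cst (desc k) []) (set k)
  -- `(D : Desc) → ⟦D⟧ (μ D) → μ D`
  | con k => pi (cst (desc k) [])
      (arrow (cst (interp k) [var 0, cst (mu k) [var 0]]) (cst (mu k) [var 0]))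
  -- `(D : Desc) (X : Set) (P : X → Set) (xs : ⟦D⟧ X) → Set`
  | dAll k j => pi (cst (desc k) []) (pi (set k) (pi (arrow (var 0) (set j))
      (pi (cst (interp k) [var 2, var 1]) (set (max k j)))))
  -- `(D : Desc) (X : Set) (P : X → Set) (p : (x : X) → P x) (xs : ⟦D⟧ X) → All D X P xs`
  | dEvery k j => pi (cst (desc k) []) (pi (set k) (pi (arrow (var 0) (set j))
      (pi (pi (var 1) (app (var 1) (var 0)))
        (pi (cst (interp k) [var 3, var 2])
          (cst (dAll k j) [var 4, var 3, var 2, var 0])))))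
  -- `(D : Desc) (P : μ D → Set)`
  -- `  (h : (d : ⟦D⟧ (μ D)) → All D (μ D) P d → P (in d)) (x : μ D) → P x`
  | dInd k j => pi (cst (desc k) []) (pi (arrow (cst (mu k) [var 0]) (set j))
      (pi (pi (cst (interp k) [var 1, cst (mu k) [var 1]])
            (arrow (cst (dAll k j) [var 2, cst (mu k) [var 2], var 1, var 0])
              (app (var 1) (cst (con k) [var 2, var 0]))))
        (pi (cst (mu k) [var 2]) (app (var 2) (var 0)))))
  -- `(I : Set) → Set₁`
  | idesc k => pi (set k) (set (k + 1))
  -- `(I : Set) (i : I) → IDesc I`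
  | iVar k => pi (set k) (pi (var 0) (cst (idesc k) [var 1]))
  | iUnit k => pi (set k) (cst (idesc k) [var 0])
  | iTimes k => pi (set k) (arrow (cst (idesc k) [var 0])
      (arrow (cst (idesc k) [var 0]) (cst (idesc k) [var 0])))
  -- `(I : Set) (S : Set) (T : S → IDesc I) → IDesc I`
  | iPi k => pi (set k) (pi (set k)
      (arrow (arrow (var 0) (cst (idesc k) [var 1])) (cst (idesc k) [var 1])))
  | iSigma k => pi (set k) (pi (set k)
      (arrow (arrow (var 0) (cst (idesc k) [var 1])) (cst (idesc k) [var 1])))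
  -- `(I : Set) (E : EnumU) (T : EnumT E → IDesc I) → IDesc I`
  | isigma k => pi (set k) (pi (cst enumU [])
      (arrow (arrow (cst enumT [var 0]) (cst (idesc k) [var 1])) (cst (idesc k) [var 1])))
  -- `(I : Set) (D : IDesc I) (X : I → Set) → Set`
  | iInterp k => pi (set k) (pi (cst (idesc k) [var 0]) (pi (arrow (var 1) (set k)) (set k)))
  -- `(I : Set) (R : I → IDesc I) (i : I) → Set`
  | imu k => pi (set k) (pi (arrow (var 0) (cst (idesc k) [var 0])) (pi (var 1) (set k)))
  -- `(I : Set) (R : I → IDesc I) (i : I) → ⟦R i⟧ (μ R) → μ R i`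
  | icon k => pi (set k) (pi (arrow (var 0) (cst (idesc k) [var 0])) (pi (var 1)
      (arrow (cst (iInterp k) [var 2, app (var 1) (var 0), cst (imu k) [var 2, var 1]])
        (cst (imu k) [var 2, var 1, var 0]))))
  -- `(I : Set) (D : IDesc I) (X : I → Set) (xs : ⟦D⟧ X) (P : ((i : I) × X i) → Set) → Set`
  | iAll k j => pi (set k) (pi (cst (idesc k) [var 0]) (pi (arrow (var 1) (set k))
      (pi (cst (iInterp k) [var 2, var 1, var 0])
        (pi (arrow (sigma (var 3) (app (var 2) (var 0))) (set j)) (set (max k j))))))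
  -- `(I : Set) (D : IDesc I) (X : I → Set) (P : ((i : I) × X i) → Set)`
  -- `  (p : (i : I) (x : X i) → P (i, x)) (xs : ⟦D⟧ X) → IAll D X xs P`
  | iEvery k j => pi (set k) (pi (cst (idesc k) [var 0]) (pi (arrow (var 1) (set k))
      (pi (arrow (sigma (var 2) (app (var 1) (var 0))) (set j))
        (pi (pi (var 3) (pi (app (var 2) (var 0))
              (app (var 2) (pair (var 1) (var 0) (app (var 4) (var 0))))))
          (pi (cst (iInterp k) [var 4, var 3, var 2])
            (cst (iAll k j) [var 5, var 4, var 3, var 0, var 2]))))))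
  -- `(I : Set) (R : I → IDesc I) (P : ((i : I) × μ R i) → Set)`
  -- `  (h : (i : I) (xs : ⟦R i⟧ (μ R)) → IAll (R i) (μ R) xs P → P (i, in xs))`
  -- `  (i : I) (x : μ R i) → P (i, x)`
  | iInd k j => pi (set k) (pi (arrow (var 0) (cst (idesc k) [var 0]))
      (pi (arrow (sigma (var 1) (cst (imu k) [var 2, var 1, var 0])) (set j))
        (pi (pi (var 2)
              (pi (cst (iInterp k) [var 3, app (var 2) (var 0), cst (imu k) [var 3, var 2]])
                (arrow
                  (cst (iAll k j)
                    [var 4, app (var 3) (var 1), cst (imu k) [var 4, var 3], var 0, var 2])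
                  (app (var 2) (pair (var 1) (cst (icon k) [var 4, var 3, var 1, var 0])
                    (cst (imu k) [var 5, var 4, var 0]))))))
          (pi (var 3) (pi (cst (imu k) [var 4, var 3, var 0])
            (app (var 3) (pair (var 1) (var 0) (cst (imu k) [var 6, var 5, var 0]))))))))

/-! ### Computation rules of the constants -/

open LabelTT.Const in
/-- `Computes s t`: the term `s`, an operator of one of the universes applied to a canonical form,
computes to `t`. -/
inductive Computes : Tm → Tm → Prop
  -- `π` and its eliminator
  | spi_nil {k P} : Computes (cst (spi k) [cst nilE [], P]) unit
  | spi_cons {k t E P} :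
      Computes (cst (spi k) [cst consE [t, E], P])
        (prod (app P (cst zeE [t, E]))
          (cst (spi k) [E, lam (cst enumT [E]) (app P.wk (cst suE [t.wk, E.wk, var 0]))]))
  | switch_ze {k t E P b} :
      Computes (cst (switch k) [cst consE [t, E], P, b, cst zeE [t, E]]) (fst b)
  | switch_su {k t E P b x} :
      Computes (cst (switch k) [cst consE [t, E], P, b, cst suE [t, E, x]])
        (cst (switch k)
          [E, lam (cst enumT [E]) (app P.wk (cst suE [t.wk, E.wk, var 0])), snd b, x])
  -- `⟦D⟧ X`
  | interp_var {k X} : Computes (cst (interp k) [cst (dVar k) [], X]) X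
  | interp_unit {k X} : Computes (cst (interp k) [cst (dUnit k) [], X]) unit
  | interp_times {k A B X} :
      Computes (cst (interp k) [cst (dTimes k) [A, B], X])
        (prod (cst (interp k) [A, X]) (cst (interp k) [B, X]))
  | interp_pi {k S T X} :
      Computes (cst (interp k) [cst (dPi k) [S, T], X])
        (pi S (cst (interp k) [app T.wk (var 0), X.wk]))
  | interp_Sigma {k S T X} :
      Computes (cst (interp k) [cst (dSigma k) [S, T], X])
        (Tm.sigma S (cst (interp k) [app T.wk (var 0), X.wk]))
  | interp_sigma {k E T X} :
      Computes (cst (interp k) [cst (dsigma k) [E, T], X])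
        (Tm.sigma (cst enumT [E]) (cst (interp k) [app T.wk (var 0), X.wk]))
  -- `All D X P xs`
  | all_var {k j X P xs} :
      Computes (cst (dAll k j) [cst (dVar k) [], X, P, xs]) (app P xs)
  | all_unit {k j X P xs} :
      Computes (cst (dAll k j) [cst (dUnit k) [], X, P, xs]) unit
  | all_times {k j A B X P xs} :
      Computes (cst (dAll k j) [cst (dTimes k) [A, B], X, P, xs])
        (prod (cst (dAll k j) [A, X, P, fst xs]) (cst (dAll k j) [B, X, P, snd xs]))
  | all_pi {k j S T X P xs} :
      Computes (cst (dAll k j) [cst (dPi k) [S, T], X, P, xs])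
        (pi S (cst (dAll k j) [app T.wk (var 0), X.wk, P.wk, app xs.wk (var 0)]))
  | all_Sigma {k j S T X P xs} :
      Computes (cst (dAll k j) [cst (dSigma k) [S, T], X, P, xs])
        (cst (dAll k j) [app T (fst xs), X, P, snd xs])
  | all_sigma {k j E T X P xs} :
      Computes (cst (dAll k j) [cst (dsigma k) [E, T], X, P, xs])
        (cst (dAll k j) [app T (fst xs), X, P, snd xs])
  -- `p` applied at every recursive position
  | every_var {k j X P p xs} :
      Computes (cst (dEvery k j) [cst (dVar k) [], X, P, p, xs]) (app p xs)
  | every_unit {k j X P p xs} :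
      Computes (cst (dEvery k j) [cst (dUnit k) [], X, P, p, xs]) void
  | every_times {k j A B X P p xs} :
      Computes (cst (dEvery k j) [cst (dTimes k) [A, B], X, P, p, xs])
        (npair (cst (dEvery k j) [A, X, P, p, fst xs]) (cst (dEvery k j) [B, X, P, p, snd xs])
          (cst (dAll k j) [B, X, P, snd xs]))
  | every_pi {k j S T X P p xs} :
      Computes (cst (dEvery k j) [cst (dPi k) [S, T], X, P, p, xs])
        (lam S (cst (dEvery k j)
          [app T.wk (var 0), X.wk, P.wk, p.wk, app xs.wk (var 0)]))
  | every_Sigma {k j S T X P p xs} :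
      Computes (cst (dEvery k j) [cst (dSigma k) [S, T], X, P, p, xs])
        (cst (dEvery k j) [app T (fst xs), X, P, p, snd xs])
  | every_sigma {k j E T X P p xs} :
      Computes (cst (dEvery k j) [cst (dsigma k) [E, T], X, P, p, xs])
        (cst (dEvery k j) [app T (fst xs), X, P, p, snd xs])
  -- induction
  | ind_con {k j D P h xs} :
      Computes (cst (dInd k j) [D, P, h, cst (con k) [D, xs]])
        (apps h [xs, cst (dEvery k j) [D, cst (mu k) [D], P, cst (dInd k j) [D, P, h], xs]])
  -- the same for inductive families
  | iinterp_var {k I i X} :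
      Computes (cst (iInterp k) [I, cst (iVar k) [I, i], X]) (app X i)
  | iinterp_unit {k I X} : Computes (cst (iInterp k) [I, cst (iUnit k) [I], X]) unit
  | iinterp_times {k I A B X} :
      Computes (cst (iInterp k) [I, cst (iTimes k) [I, A, B], X])
        (prod (cst (iInterp k) [I, A, X]) (cst (iInterp k) [I, B, X]))
  | iinterp_pi {k I S T X} :
      Computes (cst (iInterp k) [I, cst (iPi k) [I, S, T], X])
        (pi S (cst (iInterp k) [I.wk, app T.wk (var 0), X.wk]))
  | iinterp_Sigma {k I S T X} :
      Computes (cst (iInterp k) [I, cst (iSigma k) [I, S, T], X])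
        (Tm.sigma S (cst (iInterp k) [I.wk, app T.wk (var 0), X.wk]))
  | iinterp_sigma {k I E T X} :
      Computes (cst (iInterp k) [I, cst (isigma k) [I, E, T], X])
        (Tm.sigma (cst enumT [E]) (cst (iInterp k) [I.wk, app T.wk (var 0), X.wk]))
  | iall_var {k j I i X xs P} :
      Computes (cst (iAll k j) [I, cst (iVar k) [I, i], X, xs, P])
        (app P (pair i xs (app X.wk (var 0))))
  | iall_unit {k j I X xs P} :
      Computes (cst (iAll k j) [I, cst (iUnit k) [I], X, xs, P]) unit
  | iall_times {k j I A B X xs P} :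
      Computes (cst (iAll k j) [I, cst (iTimes k) [I, A, B], X, xs, P])
        (prod (cst (iAll k j) [I, A, X, fst xs, P]) (cst (iAll k j) [I, B, X, snd xs, P]))
  | iall_pi {k j I S T X xs P} :
      Computes (cst (iAll k j) [I, cst (iPi k) [I, S, T], X, xs, P])
        (pi S (cst (iAll k j)
          [I.wk, app T.wk (var 0), X.wk, app xs.wk (var 0), P.wk]))
  | iall_Sigma {k j I S T X xs P} :
      Computes (cst (iAll k j) [I, cst (iSigma k) [I, S, T], X, xs, P])
        (cst (iAll k j) [I, app T (fst xs), X, snd xs, P])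
  | iall_sigma {k j I E T X xs P} :
      Computes (cst (iAll k j) [I, cst (isigma k) [I, E, T], X, xs, P])
        (cst (iAll k j) [I, app T (fst xs), X, snd xs, P])
  | ievery_var {k j I i X P p xs} :
      Computes (cst (iEvery k j) [I, cst (iVar k) [I, i], X, P, p, xs]) (apps p [i, xs])
  | ievery_unit {k j I X P p xs} :
      Computes (cst (iEvery k j) [I, cst (iUnit k) [I], X, P, p, xs]) void
  | ievery_times {k j I A B X P p xs} :
      Computes (cst (iEvery k j) [I, cst (iTimes k) [I, A, B], X, P, p, xs])
        (npair (cst (iEvery k j) [I, A, X, P, p, fst xs])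
          (cst (iEvery k j) [I, B, X, P, p, snd xs]) (cst (iAll k j) [I, B, X, snd xs, P]))
  | ievery_pi {k j I S T X P p xs} :
      Computes (cst (iEvery k j) [I, cst (iPi k) [I, S, T], X, P, p, xs])
        (lam S (cst (iEvery k j)
          [I.wk, app T.wk (var 0), X.wk, P.wk, p.wk, app xs.wk (var 0)]))
  | ievery_Sigma {k j I S T X P p xs} :
      Computes (cst (iEvery k j) [I, cst (iSigma k) [I, S, T], X, P, p, xs])
        (cst (iEvery k j) [I, app T (fst xs), X, P, p, snd xs])
  | ievery_sigma {k j I E T X P p xs} :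
      Computes (cst (iEvery k j) [I, cst (isigma k) [I, E, T], X, P, p, xs])
        (cst (iEvery k j) [I, app T (fst xs), X, P, p, snd xs])
  | iind_con {k j I R P h i xs} :
      Computes (cst (iInd k j) [I, R, P, h, i, cst (icon k) [I, R, i, xs]])
        (apps h [i, xs, cst (iEvery k j)
          [I, app R i, cst (imu k) [I, R], P, cst (iInd k j) [I, R, P, h], xs]])

/-! ### Contexts and judgments -/

/-- A context entry is a declaration `x : S` or a definition `x ↦ t : S`. -/
inductive Entry : Type
  | decl (S : Tm)
  | defn (t S : Tm)

def Entry.type : Entry → Tm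
  | decl S => S
  | defn _ S => S

/-- Contexts; the head of the list is the most recent entry. -/
abbrev Ctx := List Entry

/-- `Lookup Γ x S`: the variable `x` has type `S` in `Γ`. -/
inductive Lookup : Ctx → ℕ → Tm → Prop
  | here {Γ e} : Lookup (e :: Γ) 0 e.type.wk
  | there {Γ e x S} : Lookup Γ x S → Lookup (e :: Γ) (x + 1) S.wk

/-- `LookupDef Γ x t S`: the variable `x` is defined as `t : S` in `Γ`. -/
inductive LookupDef : Ctx → ℕ → Tm → Tm → Prop
  | here {Γ t S} : LookupDef (.defn t S :: Γ) 0 t.wk S.wk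
  | there {Γ e x t S} : LookupDef Γ x t S → LookupDef (e :: Γ) (x + 1) t.wk S.wk

inductive Judgment : Type
  | valid (Γ : Ctx)                  -- `Γ ⊢ VALID`
  | typing (Γ : Ctx) (t T : Tm)      -- `Γ ⊢ t : T`
  | equal (Γ : Ctx) (s t T : Tm)     -- `Γ ⊢ s ≡ t : T`
  | label (Γ : Ctx) (l : Tm)         -- `Γ ⊢ l : label`
  | labelEq (Γ : Ctx) (l m : Tm)     -- `Γ ⊢ l ≡ m : label`

open LabelTT.Judgment in
/-- Derivability of the judgments of the (internal) type theory. -/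
inductive Derivable : Judgment → Prop
  -- context validity
  | nil : Derivable (valid [])
  | decl {Γ S k} : Derivable (valid Γ) → Derivable (typing Γ S (set k)) →
      Derivable (valid (.decl S :: Γ))
  | defn {Γ t S k} : Derivable (valid Γ) → Derivable (typing Γ S (set k)) →
      Derivable (typing Γ t S) → Derivable (valid (.defn t S :: Γ))
  -- typing
  | var {Γ x S} : Derivable (valid Γ) → Lookup Γ x S → Derivable (typing Γ (var x) S)
  | conv {Γ t S T k} : Derivable (typing Γ t S) → Derivable (typing Γ T (set k)) →
      Derivable (equal Γ S T (set k)) → Derivable (typing Γ t T)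
  | cumul {Γ S k} : Derivable (typing Γ S (set k)) → Derivable (typing Γ S (set (k + 1)))
  | set {Γ k} : Derivable (valid Γ) → Derivable (typing Γ (set k) (set (k + 1)))
  | pi {Γ S T k} : Derivable (typing Γ S (set k)) →
      Derivable (typing (.decl S :: Γ) T (set k)) → Derivable (typing Γ (pi S T) (set k))
  | lam {Γ S t T k} : Derivable (typing Γ S (set k)) →
      Derivable (typing (.decl S :: Γ) t T) → Derivable (typing Γ (lam S t) (pi S T))
  | app {Γ f s S T} : Derivable (typing Γ f (pi S T)) → Derivable (typing Γ s S) →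
      Derivable (typing Γ (app f s) (T.inst s))
  | sigma {Γ S T k} : Derivable (typing Γ S (set k)) →
      Derivable (typing (.decl S :: Γ) T (set k)) → Derivable (typing Γ (sigma S T) (set k))
  | pair {Γ s t S T k} : Derivable (typing Γ S (set k)) → Derivable (typing Γ s S) →
      Derivable (typing (.decl S :: Γ) T (set k)) → Derivable (typing Γ t (T.inst s)) →
      Derivable (typing Γ (pair s t T) (sigma S T))
  | fst {Γ p S T} : Derivable (typing Γ p (sigma S T)) → Derivable (typing Γ (fst p) S)
  | snd {Γ p S T} : Derivable (typing Γ p (sigma S T)) →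
      Derivable (typing Γ (snd p) (T.inst (fst p)))
  | unit {Γ} : Derivable (valid Γ) → Derivable (typing Γ unit (set 0))
  | void {Γ} : Derivable (valid Γ) → Derivable (typing Γ void unit)
  | const {Γ c} : Derivable (valid Γ) → Derivable (typing Γ (const c) c.type)
  -- programming labels
  | lname {Γ f} : Derivable (valid Γ) → Derivable (label Γ (lname f))
  | lapp {Γ l t T} : Derivable (label Γ l) → Derivable (typing Γ t T) →
      Derivable (label Γ (lapp l t))
  | lbl {Γ l T k} : Derivable (label Γ l) → Derivable (typing Γ T (set k)) →
      Derivable (typing Γ (lbl l T) (set k))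
  | ret {Γ l t T} : Derivable (typing Γ t T) → Derivable (label Γ l) →
      Derivable (typing Γ (ret t) (lbl l T))
  | call {Γ l c T} : Derivable (typing Γ c (lbl l T)) → Derivable (typing Γ (call l T c) T)
  -- judgmental equality: computation
  | beta {Γ s t S T k} : Derivable (typing Γ S (set k)) →
      Derivable (typing (.decl S :: Γ) t T) → Derivable (typing Γ s S) →
      Derivable (equal Γ (app (lam S t) s) (t.inst s) (T.inst s))
  | fst_pair {Γ s t S T k} : Derivable (typing Γ S (set k)) → Derivable (typing Γ s S) →
      Derivable (typing (.decl S :: Γ) T (set k)) → Derivable (typing Γ t (T.inst s)) →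
      Derivable (equal Γ (fst (pair s t T)) s S)
  | snd_pair {Γ s t S T k} : Derivable (typing Γ S (set k)) → Derivable (typing Γ s S) →
      Derivable (typing (.decl S :: Γ) T (set k)) → Derivable (typing Γ t (T.inst s)) →
      Derivable (equal Γ (snd (pair s t T)) t (T.inst s))
  | delta {Γ x t S} : Derivable (valid Γ) → LookupDef Γ x t S →
      Derivable (equal Γ (var x) t S)
  | computes {Γ s t T} : Computes s t → Derivable (typing Γ s T) → Derivable (typing Γ t T) →
      Derivable (equal Γ s t T)
  | call_ret {Γ l t T} : Derivable (label Γ l) → Derivable (typing Γ t T) →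
      Derivable (equal Γ (call l T (ret t)) t T)
  -- judgmental equality: equivalence, conversion and cumulativity
  | refl {Γ t T} : Derivable (typing Γ t T) → Derivable (equal Γ t t T)
  | symm {Γ s t T} : Derivable (equal Γ s t T) → Derivable (equal Γ t s T)
  | trans {Γ s t u T} : Derivable (equal Γ s t T) → Derivable (equal Γ t u T) →
      Derivable (equal Γ s u T)
  | equal_conv {Γ s t S T k} : Derivable (equal Γ s t S) → Derivable (typing Γ T (set k)) →
      Derivable (equal Γ S T (set k)) → Derivable (equal Γ s t T)
  | equal_cumul {Γ S T k} : Derivable (equal Γ S T (set k)) →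
      Derivable (equal Γ S T (set (k + 1)))
  -- judgmental equality: congruence
  | pi_congr {Γ S S' T T' k} : Derivable (typing Γ S (set k)) →
      Derivable (equal Γ S S' (set k)) → Derivable (equal (.decl S :: Γ) T T' (set k)) →
      Derivable (equal Γ (pi S T) (pi S' T') (set k))
  | lam_congr {Γ S S' t t' T k} : Derivable (typing Γ S (set k)) →
      Derivable (equal Γ S S' (set k)) → Derivable (equal (.decl S :: Γ) t t' T) →
      Derivable (equal Γ (lam S t) (lam S' t') (pi S T))
  | app_congr {Γ f f' s s' S T} : Derivable (equal Γ f f' (pi S T)) →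
      Derivable (equal Γ s s' S) → Derivable (equal Γ (app f s) (app f' s') (T.inst s))
  | sigma_congr {Γ S S' T T' k} : Derivable (typing Γ S (set k)) →
      Derivable (equal Γ S S' (set k)) → Derivable (equal (.decl S :: Γ) T T' (set k)) →
      Derivable (equal Γ (sigma S T) (sigma S' T') (set k))
  | pair_congr {Γ s s' t t' S T T' k} : Derivable (typing Γ S (set k)) →
      Derivable (equal Γ s s' S) → Derivable (equal (.decl S :: Γ) T T' (set k)) →
      Derivable (equal Γ t t' (T.inst s)) →
      Derivable (equal Γ (pair s t T) (pair s' t' T') (sigma S T))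
  | fst_congr {Γ p p' S T} : Derivable (equal Γ p p' (sigma S T)) →
      Derivable (equal Γ (fst p) (fst p') S)
  | snd_congr {Γ p p' S T} : Derivable (equal Γ p p' (sigma S T)) →
      Derivable (equal Γ (snd p) (snd p') (T.inst (fst p)))
  | lname_congr {Γ f} : Derivable (valid Γ) → Derivable (labelEq Γ (lname f) (lname f))
  | lapp_congr {Γ l l' t t' T} : Derivable (labelEq Γ l l') → Derivable (equal Γ t t' T) →
      Derivable (labelEq Γ (lapp l t) (lapp l' t'))
  | lbl_congr {Γ l l' T T' k} : Derivable (labelEq Γ l l') →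
      Derivable (equal Γ T T' (set k)) → Derivable (equal Γ (lbl l T) (lbl l' T') (set k))
  | ret_congr {Γ l t t' T} : Derivable (equal Γ t t' T) → Derivable (label Γ l) →
      Derivable (equal Γ (ret t) (ret t') (lbl l T))
  | call_congr {Γ l l' T T' c c' k} : Derivable (labelEq Γ l l') →
      Derivable (equal Γ T T' (set k)) → Derivable (equal Γ c c' (lbl l T)) →
      Derivable (equal Γ (call l T c) (call l' T' c') T)

/-- `Γ ⊢ VALID`. -/
abbrev Valid (Γ : Ctx) : Prop := Derivable (.valid Γ)

/-- `Γ ⊢ t : T`. -/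
abbrev HasType (Γ : Ctx) (t T : Tm) : Prop := Derivable (.typing Γ t T)

/-- `Γ ⊢ s ≡ t : T`. -/
abbrev EqTm (Γ : Ctx) (s t T : Tm) : Prop := Derivable (.equal Γ s t T)

/-! ### Telescopes -/

/-- A telescope `(x₁ : X₁) … (xₙ : Xₙ)`, outermost type first; each type may refer to the
previous variables. -/
abbrev Tele := List Tm

/-- `Γ, x₁ : X₁, …, xₙ : Xₙ`. -/
def Ctx.extend : Ctx → Tele → Ctx
  | Γ, [] => Γ
  | Γ, X :: Xs => Ctx.extend (Entry.decl X :: Γ) Xs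

/-- `(x₁ : X₁) … (xₙ : Xₙ) → T`. -/
def Tm.piTele (Xs : Tele) (T : Tm) : Tm := Xs.foldr pi T

/-- `λ (x₁ : X₁) … (xₙ : Xₙ). t`. -/
def Tm.lamTele (Xs : Tele) (t : Tm) : Tm := Xs.foldr lam t

/-- `M₁ → … → Mₙ → T`, non-dependently. -/
def Tm.arrows (Ms : List Tm) (T : Tm) : Tm := Ms.foldr arrow T

/-- The label `f x₁ … xₙ`, where `x₁, …, xₙ` are the last `n` variables of the context. -/
def Tm.labelVars (f : String) (n : ℕ) : Tm :=
  ((List.range n).reverse.map var).foldl lapp (lname f)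

/-! ### The external language -/

/-- External terms. -/
inductive ExtTm : Type
  | var (x : ℕ)
  | set (k : ℕ)
  | pi (S T : ExtTm)
  | lam (t : ExtTm)                 -- `λ x. t`, without domain
  | app (f s : ExtTm)
  | sigma (S T : ExtTm)
  | fst (p : ExtTm)
  | snd (p : ExtTm)
  | unit
  | const (c : Const)
  | ann (t T : ExtTm)               -- type annotation `(t : T)`
  -- tuples `()` and `(x xs)`
  | nil
  | cons (x xs : ExtTm)
  -- finite sets: `{'a₁, …, 'aₙ}`, `{'a₁ ↦ e₁, …, 'aₙ ↦ eₙ}` and `'a`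
  | enum (as : List String)
  | cases (n : ℕ) (as : Fin n → String) (es : Fin n → ExtTm)
  | tag (a : String)
  -- `in t` and constructors `c a₁ … aₙ`
  | inn (t : ExtTm)
  | constr (c : String) (n : ℕ) (args : Fin n → ExtTm)
  -- programming labels
  | lname (f : String)
  | lapp (l t : ExtTm)
  | lbl (l T : ExtTm)
  | ret (t : ExtTm)
  | call (t : ExtTm)

/-- The tuple `(x₁ … xₙ)`. -/
def ExtTm.tuple (xs : List ExtTm) : ExtTm := xs.foldr ExtTm.cons ExtTm.nil

/-- `(x₁ : X₁) … (xₙ : Xₙ) → T`. -/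
def ExtTm.piTele (Xs : List ExtTm) (T : ExtTm) : ExtTm := Xs.foldr ExtTm.pi T

inductive ElabJudgment : Type
  | synth (Γ : Ctx) (e : ExtTm) (t T : Tm)   -- `e` elaborates to `t`, and its type is `T`
  | check (Γ : Ctx) (T : Tm) (e : ExtTm) (t : Tm)  -- `e`, checked against `T`, elaborates to `t`
  | label (Γ : Ctx) (e : ExtTm) (l : Tm)     -- the label `e` elaborates to the label `l`

open LabelTT.Const LabelTT.ElabJudgment in
/-- The bidirectional type checker: type synthesis and type checking. -/
inductive Elab : ElabJudgment → Prop
  -- type synthesis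
  | var {Γ x S} : Valid Γ → Lookup Γ x S → Elab (synth Γ (.var x) (var x) S)
  | const {Γ c} : Valid Γ → Elab (synth Γ (.const c) (const c) c.type)
  | ann {Γ s s' S S' k} : Elab (check Γ (set k) S S') → Elab (check Γ S' s s') →
      Elab (synth Γ (.ann s S) s' S')
  | app {Γ f f' s s' S T} : Elab (synth Γ f f' (pi S T)) → Elab (check Γ S s s') →
      Elab (synth Γ (.app f s) (app f' s') (T.inst s'))
  | fst {Γ p p' S T} : Elab (synth Γ p p' (Tm.sigma S T)) → Elab (synth Γ (.fst p) (fst p') S)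
  | snd {Γ p p' S T} : Elab (synth Γ p p' (Tm.sigma S T)) →
      Elab (synth Γ (.snd p) (snd p') (T.inst (fst p')))
  | call {Γ e c l T} : Elab (synth Γ e c (lbl l T)) →
      Elab (synth Γ (.call e) (call l T c) T)
  -- type checking: types are compared and unfolded up to judgmental equality
  | switch {Γ e t S T k} : Elab (synth Γ e t S) → EqTm Γ S T (set k) →
      Elab (check Γ T e t)
  | conv {Γ e t S T k} : HasType Γ S (set k) → EqTm Γ S T (set k) →
      Elab (check Γ S e t) → Elab (check Γ T e t)
  -- type checking: the core calculus
  | set {Γ k} : Valid Γ → Elab (check Γ (set (k + 1)) (.set k) (set k))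
  | cumul {Γ S S' k} : Elab (check Γ (set k) S S') → Elab (check Γ (set (k + 1)) S S')
  | pi {Γ S S' T T' k} : Elab (check Γ (set k) S S') →
      Elab (check (.decl S' :: Γ) (set k) T T') → Elab (check Γ (set k) (.pi S T) (pi S' T'))
  | sigma {Γ S S' T T' k} : Elab (check Γ (set k) S S') →
      Elab (check (.decl S' :: Γ) (set k) T T') →
      Elab (check Γ (set k) (.sigma S T) (Tm.sigma S' T'))
  | unit {Γ k} : Valid Γ → Elab (check Γ (set k) .unit unit)
  | lam {Γ S T t t'} : Elab (check (.decl S :: Γ) T t t') →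
      Elab (check Γ (pi S T) (.lam t) (lam S t'))
  -- tuples
  | nil {Γ} : Valid Γ → Elab (check Γ unit .nil void)
  | cons {Γ x x' xs xs' A B} : Elab (check Γ A x x') → Elab (check Γ (B.inst x') xs xs') →
      Elab (check Γ (Tm.sigma A B) (.cons x xs) (pair x' xs' B))
  -- finite sets, introduction and elimination
  | tag_uid {Γ a} : Valid Γ → Elab (check Γ (cst uid []) (.tag a) (cst (tag a) []))
  | enum_nil {Γ} : Valid Γ → Elab (check Γ (cst enumU []) (.enum []) (cst nilE []))
  | enum_cons {Γ a as E} : Elab (check Γ (cst enumU []) (.enum as) E) →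
      Elab (check Γ (cst enumU []) (.enum (a :: as)) (cst consE [cst (tag a) [], E]))
  | cases {Γ n as es E P es' k} :
      Elab (check Γ (cst enumU []) (.enum (List.ofFn as)) E) →
      HasType Γ P (arrow (cst enumT [E]) (set k)) →
      Elab (check Γ (cst (spi k) [E, P]) (.tuple (List.ofFn es)) es') →
      Elab (check Γ (pi (cst enumT [E]) (app P.wk (var 0))) (.cases n as es)
        (cst (switch k) [E, P, es']))
  -- indexing finite sets
  | tag_ze {Γ a E} : HasType Γ E (cst enumU []) →
      Elab (check Γ (cst enumT [cst consE [cst (tag a) [], E]]) (.tag a)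
        (cst zeE [cst (tag a) [], E]))
  | tag_su {Γ a b E n} : HasType Γ E (cst enumU []) →
      Elab (check Γ (cst enumT [E]) (.tag a) n) →
      Elab (check Γ (cst enumT [cst consE [cst (tag b) [], E]]) (.tag a)
        (cst suE [cst (tag b) [], E, n]))
  -- datatype constructors
  | inn {Γ D e t k} : HasType Γ D (cst (desc k) []) →
      Elab (check Γ (cst (interp k) [D, cst (mu k) [D]]) e t) →
      Elab (check Γ (cst (mu k) [D]) (.inn e) (cst (con k) [D, t]))
  | iinn {Γ I R i e t k} : HasType Γ I (set k) → HasType Γ R (arrow I (cst (idesc k) [I])) →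
      HasType Γ i I →
      Elab (check Γ (cst (iInterp k) [I, app R i, cst (imu k) [I, R]]) e t) →
      Elab (check Γ (cst (imu k) [I, R, i]) (.inn e) (cst (icon k) [I, R, i, t]))
  | constr {Γ c n args E T t k} :
      Elab (check Γ (cst (mu k) [cst (dsigma k) [E, T]])
        (.inn (.tuple (.tag c :: List.ofFn args))) t) →
      Elab (check Γ (cst (mu k) [cst (dsigma k) [E, T]]) (.constr c n args) t)
  | iconstr {Γ c n args I R i E T t k} :
      EqTm Γ (app R i) (cst (isigma k) [I, E, T]) (cst (idesc k) [I]) →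
      Elab (check Γ (cst (imu k) [I, R, i]) (.inn (.tuple (.tag c :: List.ofFn args))) t) →
      Elab (check Γ (cst (imu k) [I, R, i]) (.constr c n args) t)
  -- programming labels
  | lbl {Γ l l' T T' k} : Elab (label Γ l l') → Elab (check Γ (set k) T T') →
      Elab (check Γ (set k) (.lbl l T) (lbl l' T'))
  | ret {Γ l T e t} : Elab (check Γ T e t) → Elab (check Γ (lbl l T) (.ret e) (ret t))
  | lname {Γ f} : Valid Γ → Elab (label Γ (.lname f) (lname f))
  | lapp {Γ l l' e t T} : Elab (label Γ l l') → Elab (synth Γ e t T) →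
      Elab (label Γ (.lapp l e) (lapp l' t))

/-! ### Programs -/

/-- Program bodies: `pt ↦ e` (return) and `pt ⇐ e { p₁, …, pₙ }` (by).  Patterns are external
terms, of the form `f p₁ … pₘ`. -/
inductive Prog : Type
  | ret (pt e : ExtTm)
  | by (pt e : ExtTm) (n : ℕ) (ps : Fin n → Prog)

/-- `ElabProg Match EWM Γ p l T t`: in `Γ`, the program body `p` realizes the programming label
type `⟨l : T⟩` by the internal term `t`.  `Match l pt` says that the pattern `pt` corresponds to
the label `l`; `EWM Γ e e' T` says that the elimination form `e` yields the internal term `e'`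
of type `T`. -/
inductive ElabProg (Match : Tm → ExtTm → Prop) (EWM : Ctx → ExtTm → Tm → Tm → Prop) :
    Ctx → Prog → Tm → Tm → Tm → Prop
  | ret {Γ pt e l T e'} : Match l pt → Elab (.check Γ T e e') →
      ElabProg Match EWM Γ (.ret pt e) l T (ret e')
  | by {Γ pt e l T e' n} {ps : Fin n → Prog} {X : Fin n → Tele} {l' S s : Fin n → Tm} :
      Match l pt →
      EWM Γ e e' (arrows (List.ofFn fun i => piTele (X i) (lbl (l' i) (S i))) (lbl l T)) →
      (∀ i, ElabProg Match EWM (Γ.extend (X i)) (ps i) (l' i) (S i) (s i)) →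
      ElabProg Match EWM Γ (.by pt e n ps) l T
        (apps e' (List.ofFn fun i => lamTele (X i) (s i)))

/-- `ElabLet Match EWM Γ f Xs T t Δ`: in `Γ`, the program declaration `let f Xs : T` with body `t`
elaborates to the context `Δ`. -/
inductive ElabLet (Match : Tm → ExtTm → Prop) (EWM : Ctx → ExtTm → Tm → Tm → Prop) :
    Ctx → String → List ExtTm → ExtTm → Prog → Ctx → Prop
  | intro {Γ f Xs T t Xs' T' t' k} : Xs'.length = Xs.length →
      Elab (.check Γ (set k) (.piTele Xs T) (piTele Xs' T')) →
      ElabProg Match EWM (Γ.extend Xs') t (labelVars f Xs'.length) T' t' →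
      ElabLet Match EWM Γ f Xs T t
        (.defn (lamTele Xs' (call (labelVars f Xs'.length) T' t')) (piTele Xs' T') :: Γ)

end LabelTT

namespace LabelTT

open Tm

/-! ### Renaming and substitution -/

namespace Tm

/-! A valid context may be extended by a definition once its type is a type and its body has that
type, so the whole matter is to type the body `λ x. call ⟨f x : T'⟩ t'`. The difficulty is that the
elaborator omits checks: its rules for abstractions, tuples and `return` do not verify that the type
being checked against is well formed, and no rule verifies the label of the declaration. The
invariant is therefore conditional: type checking is sound against a target that is a type
(`Elab.sound`), and a program body is sound for a label type that is well formed (`ElabProg.sound`).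

Two facts keep this condition alive. Regularity (`Derivable.presupposed`) says that whatever has
been typed, synthesised or yielded by an elimination form has a type that is itself a type.
Inversion (`IsType.of_pi`, `IsType.of_sigma`, `IsType.of_lbl`) splits such a type into well-formed
components. Inversion concerns type formers as subjects of typing derivations, so neither
confluence, nor normalisation, nor injectivity of type formers up to equality is needed.

Regularity rests on stability under substitution, because the types of applications and projections
are instances. One induction (`Derivable.subst_of_class`) serves twice: first for renamings, which
give weakening, then for typed substitutions, whose lifting under a binder uses weakening.
Regularity also needs the declared types of all constants to be types (`Const.isType_type`). -/

theorem liftSub_var_comp (ξ : ℕ → ℕ) :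
    liftSub (fun x => var (ξ x)) = fun x => var (liftRen ξ x) := by
  funext x; cases x <;> rfl

theorem rename_eq_subst (t : Tm) (ξ : ℕ → ℕ) : t.rename ξ = t.subst fun x => var (ξ x) := by
  induction t generalizing ξ <;> simp_all [rename, subst, liftSub_var_comp]

theorem liftSub_var : liftSub var = var := by
  funext x; cases x <;> rfl

@[simp] theorem subst_var (t : Tm) : t.subst var = t := by
  induction t <;> simp_all [subst, liftSub_var]

theorem subst_rename (t : Tm) (ξ : ℕ → ℕ) (σ : ℕ → Tm) :
    (t.rename ξ).subst σ = t.subst fun x => σ (ξ x) := by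
  have lift (ξ : ℕ → ℕ) (σ : ℕ → Tm) :
      (fun x => liftSub σ (liftRen ξ x)) = liftSub fun x => σ (ξ x) := by
    funext x; cases x <;> rfl
  induction t generalizing ξ σ <;> simp_all [rename, subst]

theorem rename_subst (t : Tm) (σ : ℕ → Tm) (ξ : ℕ → ℕ) :
    (t.subst σ).rename ξ = t.subst fun x => (σ x).rename ξ := by
  have lift (σ : ℕ → Tm) (ξ : ℕ → ℕ) :
      (fun x => (liftSub σ x).rename (liftRen ξ)) = liftSub fun x => (σ x).rename ξ := by
    funext x
    cases x with
    | zero => rfl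
    | succ x =>
      simp only [liftSub]
      -- Two renamings are composed by reading the outer one as a substitution, so that
      -- `subst_rename` applies to both sides.
      rw [rename_eq_subst _ (liftRen ξ), wk, wk, subst_rename, rename_eq_subst ((σ x).rename ξ),
        subst_rename]
      rfl
  induction t generalizing σ ξ <;> simp_all [rename, subst]

theorem wk_subst_liftSub (t : Tm) (σ : ℕ → Tm) : t.wk.subst (liftSub σ) = (t.subst σ).wk := by
  rw [wk, wk, subst_rename, rename_subst]; rfl

theorem subst_subst (t : Tm) (σ τ : ℕ → Tm) :
    (t.subst σ).subst τ = t.subst fun x => (σ x).subst τ := by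
  have lift (σ τ : ℕ → Tm) :
      (fun x => (liftSub σ x).subst (liftSub τ)) = liftSub fun x => (σ x).subst τ := by
    funext x
    cases x with
    | zero => rfl
    | succ x => exact wk_subst_liftSub _ _
  induction t generalizing σ τ <;> simp_all [subst]

@[simp] theorem wk_inst (t s : Tm) : t.wk.inst s = t := by
  rw [wk, inst, subst_rename]; exact subst_var t

/-- Both sides are a single substitution. They agree on the last variable by computation, and on the
others because instantiation cancels weakening. This matches types in the rules whose conclusion or
premise mentions an instance. -/
theorem inst_subst (t s : Tm) (σ : ℕ → Tm) :
    (t.inst s).subst σ = (t.subst (liftSub σ)).inst (s.subst σ) := by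
  rw [inst, inst, subst_subst, subst_subst]
  congr 1
  funext x
  cases x with
  | zero => rfl
  | succ x => exact (wk_inst (σ x) (s.subst σ)).symm

theorem wk_rename_liftRen (t : Tm) (ξ : ℕ → ℕ) :
    t.wk.rename (liftRen ξ) = (t.rename ξ).wk := by
  rw [rename_eq_subst, ← liftSub_var_comp, wk_subst_liftSub, rename_eq_subst t]

theorem apps_subst (f : Tm) (ss : List Tm) (σ : ℕ → Tm) :
    (f.apps ss).subst σ = (f.subst σ).apps (ss.map (subst σ)) := by
  induction ss generalizing f with
  | nil => rfl
  | cons s ss ih => exact ih (app f s)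

theorem cst_subst (c : Const) (ss : List Tm) (σ : ℕ → Tm) :
    (cst c ss).subst σ = cst c (ss.map (subst σ)) :=
  apps_subst _ _ _

end Tm

/-! ### Stability of derivability under renaming and substitution. -/

theorem Const.type_subst (c : Const) (σ : ℕ → Tm) : c.type.subst σ = c.type := by
  cases c <;> rfl

/-- The rules are schematic in their arguments, so a substituted instance is an instance again.
Under binders the arguments occur weakened, and weakening commutes with lifted substitutions. -/
theorem Computes.subst {s t : Tm} (h : Computes s t) (σ : ℕ → Tm) :
    Computes (s.subst σ) (t.subst σ) := by
  cases h <;>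
    simp only [cst_subst, apps_subst, List.map, prod, npair, Tm.subst, wk_subst_liftSub, liftSub] <;>
    constructor

/-- The context of a judgment. -/
def Judgment.ctx : Judgment → Ctx
  | valid Γ => Γ
  | typing Γ _ _ => Γ
  | equal Γ _ _ _ => Γ
  | label Γ _ => Γ
  | labelEq Γ _ _ => Γ

/-- The judgment obtained by applying a substitution with codomain `Δ`. -/
def Judgment.subst (Δ : Ctx) (σ : ℕ → Tm) : Judgment → Judgment
  | valid _ => valid Δ
  | typing _ t T => typing Δ (t.subst σ) (T.subst σ)
  | equal _ s t T => equal Δ (s.subst σ) (t.subst σ) (T.subst σ)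
  | label _ l => label Δ (l.subst σ)
  | labelEq _ l m => labelEq Δ (l.subst σ) (m.subst σ)

/-- Every context of a derivable judgment is valid. -/
theorem Derivable.valid_ctx {J : Judgment} (h : Derivable J) : Valid J.ctx := by
  induction h with
  | decl hΓ hS _ _ => exact .decl hΓ hS
  | defn hΓ hS ht _ _ _ => exact .defn hΓ hS ht
  | nil => exact .nil
  | _ => assumption

theorem HasType.valid {Γ : Ctx} {t T : Tm} (h : HasType Γ t T) : Valid Γ :=
  Derivable.valid_ctx h

/-- Derivability is preserved by every class of substitutions that is closed under lifting and
respects the declarations and the definitions of contexts. -/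
theorem Derivable.subst_of_class {Good : Ctx → (ℕ → Tm) → Ctx → Prop}
    (hvar : ∀ {Γ σ Δ x S}, Good Γ σ Δ → Valid Δ → Lookup Γ x S → HasType Δ (σ x) (S.subst σ))
    (hdef : ∀ {Γ σ Δ x t S}, Good Γ σ Δ → Valid Δ → LookupDef Γ x t S →
      EqTm Δ (σ x) (t.subst σ) (S.subst σ))
    (hlift : ∀ {Γ σ Δ S}, Good Γ σ Δ → Valid (.decl (S.subst σ) :: Δ) →
      Good (.decl S :: Γ) (liftSub σ) (.decl (S.subst σ) :: Δ))
    {J : Judgment} (h : Derivable J) {Δ : Ctx} {σ : ℕ → Tm} (hΔ : Valid Δ)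
    (hσ : Good J.ctx σ Δ) : Derivable (J.subst Δ σ) := by
  -- Used at every binder: the induction hypothesis for the domain makes the extended target context
  -- valid, which is what `hlift` asks for. The binder rules carry a typing premise for the domain
  -- that supplies this.
  have ext {Γ S k} {Δ : Ctx} {σ : ℕ → Tm} (hΔ : Valid Δ) (hσ : Good Γ σ Δ)
      (hS : HasType Δ (S.subst σ) (.set k)) :
      Valid (.decl (S.subst σ) :: Δ) ∧ Good (.decl S :: Γ) (liftSub σ) (.decl (S.subst σ) :: Δ) :=
    ⟨.decl hΔ hS, hlift hσ (.decl hΔ hS)⟩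
  induction h generalizing Δ σ with
  | nil | decl | defn => exact hΔ
  | var _ hx => exact hvar hσ hΔ hx
  | delta _ hx => exact hdef hσ hΔ hx
  | @const _ c =>
    rw [Judgment.subst, Const.type_subst]
    exact .const hΔ
  | computes hc _ _ ih₁ ih₂ => exact .computes (hc.subst σ) (ih₁ hΔ hσ) (ih₂ hΔ hσ)
  | pi _ _ ih₁ ih₂ =>
    have e := ext hΔ hσ (ih₁ hΔ hσ)
    exact .pi (ih₁ hΔ hσ) (ih₂ e.1 e.2)
  | lam _ _ ih₁ ih₂ =>
    have e := ext hΔ hσ (ih₁ hΔ hσ)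
    exact .lam (ih₁ hΔ hσ) (ih₂ e.1 e.2)
  | sigma _ _ ih₁ ih₂ =>
    have e := ext hΔ hσ (ih₁ hΔ hσ)
    exact .sigma (ih₁ hΔ hσ) (ih₂ e.1 e.2)
  | app _ _ ih₁ ih₂ =>
    simp only [Judgment.subst, inst_subst]
    exact .app (ih₁ hΔ hσ) (ih₂ hΔ hσ)
  | snd _ ih =>
    simp only [Judgment.subst, inst_subst]
    exact .snd (ih hΔ hσ)
  | pair _ _ _ _ ih₁ ih₂ ih₃ ih₄ =>
    have e := ext hΔ hσ (ih₁ hΔ hσ)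
    have h₄ := ih₄ hΔ hσ
    simp only [Judgment.subst, inst_subst] at h₄
    exact .pair (ih₁ hΔ hσ) (ih₂ hΔ hσ) (ih₃ e.1 e.2) h₄
  | beta _ _ _ ih₁ ih₂ ih₃ =>
    have e := ext hΔ hσ (ih₁ hΔ hσ)
    simp only [Judgment.subst, inst_subst]
    exact .beta (ih₁ hΔ hσ) (ih₂ e.1 e.2) (ih₃ hΔ hσ)
  | fst_pair _ _ _ _ ih₁ ih₂ ih₃ ih₄ =>
    have e := ext hΔ hσ (ih₁ hΔ hσ)
    have h₄ := ih₄ hΔ hσ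
    simp only [Judgment.subst, inst_subst] at h₄
    exact .fst_pair (ih₁ hΔ hσ) (ih₂ hΔ hσ) (ih₃ e.1 e.2) h₄
  | snd_pair _ _ _ _ ih₁ ih₂ ih₃ ih₄ =>
    have e := ext hΔ hσ (ih₁ hΔ hσ)
    have h₄ := ih₄ hΔ hσ
    simp only [Judgment.subst, inst_subst] at h₄ ⊢
    exact .snd_pair (ih₁ hΔ hσ) (ih₂ hΔ hσ) (ih₃ e.1 e.2) h₄
  | pi_congr _ _ _ ih₁ ih₂ ih₃ =>
    have e := ext hΔ hσ (ih₁ hΔ hσ)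
    exact .pi_congr (ih₁ hΔ hσ) (ih₂ hΔ hσ) (ih₃ e.1 e.2)
  | lam_congr _ _ _ ih₁ ih₂ ih₃ =>
    have e := ext hΔ hσ (ih₁ hΔ hσ)
    exact .lam_congr (ih₁ hΔ hσ) (ih₂ hΔ hσ) (ih₃ e.1 e.2)
  | sigma_congr _ _ _ ih₁ ih₂ ih₃ =>
    have e := ext hΔ hσ (ih₁ hΔ hσ)
    exact .sigma_congr (ih₁ hΔ hσ) (ih₂ hΔ hσ) (ih₃ e.1 e.2)
  | app_congr _ _ ih₁ ih₂ =>
    simp only [Judgment.subst, inst_subst]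
    exact .app_congr (ih₁ hΔ hσ) (ih₂ hΔ hσ)
  | snd_congr _ ih =>
    simp only [Judgment.subst, inst_subst]
    exact .snd_congr (ih hΔ hσ)
  | pair_congr _ _ _ _ ih₁ ih₂ ih₃ ih₄ =>
    have e := ext hΔ hσ (ih₁ hΔ hσ)
    have h₄ := ih₄ hΔ hσ
    simp only [Judgment.subst, inst_subst] at h₄
    exact .pair_congr (ih₁ hΔ hσ) (ih₂ hΔ hσ) (ih₃ e.1 e.2) h₄
  | set => exact .set hΔ
  | unit => exact .unit hΔ
  | void => exact .void hΔ
  | lname => exact .lname hΔ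
  | lname_congr => exact .lname_congr hΔ
  | cumul _ ih => exact .cumul (ih hΔ hσ)
  | conv _ _ _ ih₁ ih₂ ih₃ => exact .conv (ih₁ hΔ hσ) (ih₂ hΔ hσ) (ih₃ hΔ hσ)
  | fst _ ih => exact .fst (ih hΔ hσ)
  | lapp _ _ ih₁ ih₂ => exact .lapp (ih₁ hΔ hσ) (ih₂ hΔ hσ)
  | lbl _ _ ih₁ ih₂ => exact .lbl (ih₁ hΔ hσ) (ih₂ hΔ hσ)
  | ret _ _ ih₁ ih₂ => exact .ret (ih₁ hΔ hσ) (ih₂ hΔ hσ)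
  | call _ ih => exact .call (ih hΔ hσ)
  | call_ret _ _ ih₁ ih₂ => exact .call_ret (ih₁ hΔ hσ) (ih₂ hΔ hσ)
  | refl _ ih => exact .refl (ih hΔ hσ)
  | symm _ ih => exact .symm (ih hΔ hσ)
  | trans _ _ ih₁ ih₂ => exact .trans (ih₁ hΔ hσ) (ih₂ hΔ hσ)
  | equal_conv _ _ _ ih₁ ih₂ ih₃ => exact .equal_conv (ih₁ hΔ hσ) (ih₂ hΔ hσ) (ih₃ hΔ hσ)
  | equal_cumul _ ih => exact .equal_cumul (ih hΔ hσ)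
  | fst_congr _ ih => exact .fst_congr (ih hΔ hσ)
  | lapp_congr _ _ ih₁ ih₂ => exact .lapp_congr (ih₁ hΔ hσ) (ih₂ hΔ hσ)
  | lbl_congr _ _ ih₁ ih₂ => exact .lbl_congr (ih₁ hΔ hσ) (ih₂ hΔ hσ)
  | ret_congr _ _ ih₁ ih₂ => exact .ret_congr (ih₁ hΔ hσ) (ih₂ hΔ hσ)
  | call_congr _ _ _ ih₁ ih₂ ih₃ => exact .call_congr (ih₁ hΔ hσ) (ih₂ hΔ hσ) (ih₃ hΔ hσ)

/-- The renaming `ξ` maps the entries of `Γ` to entries of `Δ`. -/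
structure WfRen (Γ : Ctx) (ξ : ℕ → ℕ) (Δ : Ctx) : Prop where
  lookup : ∀ {x S}, Lookup Γ x S → Lookup Δ (ξ x) (S.rename ξ)
  lookupDef : ∀ {x t S}, LookupDef Γ x t S → LookupDef Δ (ξ x) (t.rename ξ) (S.rename ξ)

theorem WfRen.succ (Γ : Ctx) (e : Entry) : WfRen Γ Nat.succ (e :: Γ) :=
  ⟨.there, .there⟩

theorem WfRen.lift {Γ Δ : Ctx} {ξ : ℕ → ℕ} (h : WfRen Γ ξ Δ) (S : Tm) :
    WfRen (.decl S :: Γ) (liftRen ξ) (.decl (S.rename ξ) :: Δ) where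
  lookup := by
    rintro _ _ (_ | hx)
    · simp only [wk_rename_liftRen]
      exact .here (e := .decl (S.rename ξ))
    · simp only [wk_rename_liftRen]
      exact .there (h.lookup hx)
  lookupDef := by
    -- The newest entry is a declaration, so a definition can only come from further back.
    rintro _ _ _ (_ | hx)
    simp only [wk_rename_liftRen]
    exact .there (h.lookupDef hx)

/-- Derivability is preserved by renaming. -/
theorem Derivable.rename {J : Judgment} (h : Derivable J) {Δ : Ctx} {ξ : ℕ → ℕ} (hΔ : Valid Δ)
    (hξ : WfRen J.ctx ξ Δ) : Derivable (J.subst Δ fun x => .var (ξ x)) := by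
  refine h.subst_of_class (Good := fun Γ σ Δ => ∃ ξ, σ = (fun x => Tm.var (ξ x)) ∧ WfRen Γ ξ Δ)
    ?_ ?_ ?_ hΔ ⟨ξ, rfl, hξ⟩
  · rintro Γ _ Δ x S ⟨ξ, rfl, hξ⟩ hΔ hx
    rw [← rename_eq_subst]
    exact .var hΔ (hξ.lookup hx)
  · rintro Γ _ Δ x t S ⟨ξ, rfl, hξ⟩ hΔ hx
    rw [← rename_eq_subst, ← rename_eq_subst]
    exact .delta hΔ (hξ.lookupDef hx)
  · rintro Γ _ Δ S ⟨ξ, rfl, hξ⟩ -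
    refine ⟨liftRen ξ, liftSub_var_comp ξ, ?_⟩
    rw [← rename_eq_subst]
    exact hξ.lift S

theorem HasType.rename {Γ Δ : Ctx} {ξ : ℕ → ℕ} {t T : Tm} (h : HasType Γ t T) (hΔ : Valid Δ)
    (hξ : WfRen Γ ξ Δ) : HasType Δ (t.rename ξ) (T.rename ξ) := by
  rw [rename_eq_subst, rename_eq_subst]
  exact Derivable.rename h hΔ hξ

theorem HasType.wk {Γ : Ctx} {e : Entry} {t T : Tm} (h : HasType Γ t T) (he : Valid (e :: Γ)) :
    HasType (e :: Γ) t.wk T.wk :=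
  h.rename he (.succ Γ e)

theorem EqTm.wk {Γ : Ctx} {e : Entry} {s t T : Tm} (h : EqTm Γ s t T) (he : Valid (e :: Γ)) :
    EqTm (e :: Γ) s.wk t.wk T.wk := by
  simp only [Tm.wk, rename_eq_subst]
  exact Derivable.rename h he (.succ Γ e)

/-- The substitution `σ` from `Γ` to `Δ` is well typed and respects the definitions of `Γ`. -/
structure WfSub (Γ : Ctx) (σ : ℕ → Tm) (Δ : Ctx) : Prop where
  lookup : ∀ {x S}, Lookup Γ x S → HasType Δ (σ x) (S.subst σ)
  lookupDef : ∀ {x t S}, LookupDef Γ x t S → EqTm Δ (σ x) (t.subst σ) (S.subst σ)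

theorem WfSub.lift {Γ Δ : Ctx} {σ : ℕ → Tm} {S : Tm} (h : WfSub Γ σ Δ)
    (hS : Valid (.decl (S.subst σ) :: Δ)) :
    WfSub (.decl S :: Γ) (liftSub σ) (.decl (S.subst σ) :: Δ) where
  lookup := by
    rintro _ _ (_ | hx)
    · simp only [wk_subst_liftSub]
      exact .var hS (.here (e := .decl (S.subst σ)))
    · simp only [wk_subst_liftSub]
      exact (h.lookup hx).wk hS
  lookupDef := by
    rintro _ _ _ (_ | hx)
    simp only [wk_subst_liftSub]
    exact (h.lookupDef hx).wk hS

/-- Derivability is preserved by well-typed substitutions. -/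
theorem Derivable.subst {J : Judgment} (h : Derivable J) {Δ : Ctx} {σ : ℕ → Tm} (hΔ : Valid Δ)
    (hσ : WfSub J.ctx σ Δ) : Derivable (J.subst Δ σ) :=
  h.subst_of_class (fun hσ _ => hσ.lookup) (fun hσ _ => hσ.lookupDef) WfSub.lift hΔ hσ

theorem WfSub.single {Γ : Ctx} {s S : Tm} (hs : HasType Γ s S) :
    WfSub (.decl S :: Γ) (single s) Γ where
  lookup := by
    rintro _ T (_ | hx)
    · rw [← inst, wk_inst]; exact hs
    · rw [← inst, wk_inst]; exact .var hs.valid hx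
  lookupDef := by
    rintro _ _ _ (_ | hx)
    rw [← inst, ← inst, wk_inst, wk_inst]
    exact .delta hs.valid hx

theorem HasType.inst {Γ : Ctx} {s S t T : Tm} (ht : HasType (.decl S :: Γ) t T)
    (hs : HasType Γ s S) : HasType Γ (t.inst s) (T.inst s) :=
  Derivable.subst ht hs.valid (.single hs)

theorem EqTm.inst {Γ : Ctx} {s S t t' T : Tm} (ht : EqTm (.decl S :: Γ) t t' T)
    (hs : HasType Γ s S) : EqTm Γ (t.inst s) (t'.inst s) (T.inst s) :=
  Derivable.subst ht hs.valid (.single hs)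

/-- The identity substitution is well typed between the two contexts: the newest variable is
converted back along the weakened equation, and all others keep their types. No separate induction
is needed. -/
theorem HasType.conv_ctx {Γ : Ctx} {S S' t T : Tm} {k : ℕ} (hS : HasType Γ S (.set k))
    (hS' : HasType Γ S' (.set k)) (e : EqTm Γ S S' (.set k))
    (ht : HasType (.decl S :: Γ) t T) : HasType (.decl S' :: Γ) t T := by
  have hv : Valid (.decl S' :: Γ) := .decl hS'.valid hS'
  have hσ : WfSub (.decl S :: Γ) var (.decl S' :: Γ) :=
    { lookup := by
        rintro _ _ (_ | hx)
        · rw [subst_var]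
          exact .conv (.var hv .here) (hS.wk hv) (EqTm.wk (.symm e) hv)
        · rw [subst_var]
          exact .var hv (.there hx)
      lookupDef := by
        rintro _ _ _ (_ | hx)
        rw [subst_var, subst_var]
        exact .delta hv (.there hx) }
  have := Derivable.subst ht hv hσ
  simpa only [Judgment.subst, subst_var] using this

/-! ### Types -/

/-- `T` is a type of some universe. -/
def IsType (Γ : Ctx) (T : Tm) : Prop := ∃ k, HasType Γ T (.set k)

theorem HasType.cumul_le {Γ : Ctx} {S : Tm} {k m : ℕ} (h : HasType Γ S (.set k)) (hkm : k ≤ m) :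
    HasType Γ S (.set m) := by
  induction hkm with
  | refl => exact h
  | step _ ih => exact .cumul ih

theorem IsType.set {Γ : Ctx} (hΓ : Valid Γ) (k : ℕ) : IsType Γ (.set k) := ⟨k + 1, .set hΓ⟩

theorem IsType.valid_decl {Γ : Ctx} {S : Tm} : IsType Γ S → Valid (.decl S :: Γ)
  | ⟨_, h⟩ => .decl h.valid h

/-- Formation wants one level for both components; cumulativity lifts them to the maximum. The
second premise may assume the extended context valid, so that a backward search for it has validity
at hand. -/
theorem IsType.pi {Γ : Ctx} {S T : Tm} (hS : IsType Γ S)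
    (hT : Valid (.decl S :: Γ) → IsType (.decl S :: Γ) T) : IsType Γ (pi S T) := by
  obtain ⟨m, hT⟩ := hT hS.valid_decl
  obtain ⟨k, hS⟩ := hS
  exact ⟨max k m, .pi (hS.cumul_le (le_max_left ..)) (hT.cumul_le (le_max_right ..))⟩

theorem IsType.sigma {Γ : Ctx} {S T : Tm} (hS : IsType Γ S)
    (hT : Valid (.decl S :: Γ) → IsType (.decl S :: Γ) T) : IsType Γ (sigma S T) := by
  obtain ⟨m, hT⟩ := hT hS.valid_decl
  obtain ⟨k, hS⟩ := hS
  exact ⟨max k m, .sigma (hS.cumul_le (le_max_left ..)) (hT.cumul_le (le_max_right ..))⟩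

theorem HasType.pair' {Γ : Ctx} {S T T' U s t : Tm} (hU : Tm.sigma S T = U)
    (hS : IsType Γ S) (hT : Valid (.decl S :: Γ) → IsType (.decl S :: Γ) T) (hs : HasType Γ s S)
    (hT' : T.inst s = T') (ht : HasType Γ t T') : HasType Γ (pair s t T) U := by
  subst hU hT'
  obtain ⟨m, hT⟩ := hT hS.valid_decl
  obtain ⟨k, hS⟩ := hS
  exact .pair (hS.cumul_le (le_max_left k m)) hs (hT.cumul_le (le_max_right k m)) ht

theorem IsType.inst {Γ : Ctx} {s S T : Tm} (hs : HasType Γ s S) :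
    IsType (.decl S :: Γ) T → IsType Γ (T.inst s)
  | ⟨k, h⟩ => ⟨k, h.inst hs⟩

theorem IsType.wk {Γ : Ctx} {e : Entry} {T : Tm} (he : Valid (e :: Γ)) :
    IsType Γ T → IsType (e :: Γ) T.wk
  | ⟨k, h⟩ => ⟨k, h.wk he⟩

/-- A term of this shape is typed only by formation, conversion or cumulativity, and the last two
keep the subject while changing its type. Hence the induction leaves the type `U` arbitrary. -/
theorem IsType.of_pi {Γ : Ctx} {S T : Tm} :
    IsType Γ (.pi S T) → IsType Γ S ∧ IsType (.decl S :: Γ) T := by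
  suffices ∀ {J}, Derivable J → ∀ {U}, J = .typing Γ (.pi S T) U → IsType Γ S ∧ IsType (.decl S :: Γ) T from
    fun ⟨_, h⟩ => this h rfl
  intro J h
  induction h <;> intro U hJ <;> cases hJ
  case pi h₁ _ h₂ _ => exact ⟨⟨_, h₁⟩, ⟨_, h₂⟩⟩
  case conv ih => exact ih rfl
  case cumul ih => exact ih rfl

theorem IsType.of_sigma {Γ : Ctx} {S T : Tm} :
    IsType Γ (.sigma S T) → IsType Γ S ∧ IsType (.decl S :: Γ) T := by
  suffices ∀ {J}, Derivable J → ∀ {U}, J = .typing Γ (.sigma S T) U → IsType Γ S ∧ IsType (.decl S :: Γ) T from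
    fun ⟨_, h⟩ => this h rfl
  intro J h
  induction h <;> intro U hJ <;> cases hJ
  case sigma h₁ _ h₂ _ => exact ⟨⟨_, h₁⟩, ⟨_, h₂⟩⟩
  case conv ih => exact ih rfl
  case cumul ih => exact ih rfl

theorem IsType.of_lbl {Γ : Ctx} {l T : Tm} :
    IsType Γ (.lbl l T) → Derivable (.label Γ l) ∧ IsType Γ T := by
  suffices ∀ {J}, Derivable J → ∀ {U}, J = .typing Γ (.lbl l T) U → Derivable (.label Γ l) ∧ IsType Γ T from
    fun ⟨_, h⟩ => this h rfl
  intro J h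
  induction h <;> intro U hJ <;> cases hJ
  case lbl h₁ _ h₂ _ => exact ⟨h₁, ⟨_, h₂⟩⟩
  case conv ih => exact ih rfl
  case cumul ih => exact ih rfl

/-! ### The types of the constants are types -/

/-- The result type is given up to an equation, so that the rule applies backwards to a goal not
visibly of the form `T.inst s`. -/
theorem HasType.app' {Γ : Ctx} {f s S T U : Tm} (hf : HasType Γ f (.pi S T)) (hs : HasType Γ s S)
    (hU : T.inst s = U) : HasType Γ (.app f s) U :=
  hU ▸ .app hf hs

theorem HasType.const' {Γ : Ctx} {c : Const} {U : Tm} (hΓ : Valid Γ) (hU : c.type = U) :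
    HasType Γ (.const c) U :=
  hU ▸ .const hΓ

theorem HasType.var' {Γ : Ctx} {x : ℕ} {S U : Tm} (hΓ : Valid Γ) (hx : Lookup Γ x S)
    (hU : S = U) : HasType Γ (.var x) U :=
  hU ▸ .var hΓ hx

theorem IsType.of_hasType {Γ : Ctx} {T : Tm} {k : ℕ} (h : HasType Γ T (.set k)) : IsType Γ T :=
  ⟨k, h⟩

set_option linter.unusedSimpArgs false in
set_option maxHeartbeats 2000000 in
-- The types are closed, explicit terms whose derivations need no conversion rule. The shape of a
-- goal thus dictates the rule to apply, and the side equations between types hold by carrying out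
-- the substitutions.
theorem Const.isType_type_nil (c : Const) : IsType [] c.type := by
  have hv : Valid [] := .nil
  cases c <;>
    simp only [Const.type, cst, apps, arrow, Tm.wk, Tm.rename, liftRen, List.foldl] <;>
    repeat' first
      | assumption
      | intro _
      | apply IsType.pi
      | apply IsType.sigma
      | apply IsType.set
      | apply IsType.of_hasType
      | apply HasType.app'
      | apply HasType.pair'
      | apply HasType.const'
      | apply HasType.var'
      | apply Lookup.here
      | apply Lookup.there
      | (simp only [Const.type, cst, apps, arrow, Tm.wk, Tm.rename, liftRen, List.foldl, inst,
          Tm.subst, single, liftSub, Entry.type]; done)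
      | (simp only [Const.type, cst, apps, arrow, Tm.wk, Tm.rename, liftRen, List.foldl, inst,
          Tm.subst, single, liftSub, Entry.type]; rfl)
      | rfl

theorem Const.isType_type {Γ : Ctx} (hΓ : Valid Γ) (c : Const) : IsType Γ c.type := by
  obtain ⟨k, h⟩ := c.isType_type_nil
  -- The empty context has no variables, so any renaming out of it is well formed; the closed type
  -- is unchanged by it.
  have := h.rename (ξ := id) hΓ ⟨nofun, nofun⟩
  rw [rename_eq_subst, c.type_subst] at this
  exact ⟨k, this⟩

/-! ### Regularity -/

theorem Valid.tail {Γ : Ctx} {e : Entry} (h : Valid (e :: Γ)) : Valid Γ := by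
  cases h <;> assumption

theorem Valid.isType_head {Γ : Ctx} {e : Entry} (h : Valid (e :: Γ)) : IsType Γ e.type := by
  cases h <;> exact ⟨_, by assumption⟩

theorem Lookup.isType {Γ : Ctx} {x : ℕ} {S : Tm} (h : Lookup Γ x S) (hΓ : Valid Γ) :
    IsType Γ S := by
  induction h with
  | here => exact hΓ.isType_head.wk hΓ
  | there _ ih => exact (ih hΓ.tail).wk hΓ

theorem LookupDef.lookup {Γ : Ctx} {x : ℕ} {t S : Tm} (h : LookupDef Γ x t S) :
    Lookup Γ x S := by
  induction h with
  | @here Γ t S => exact .here (e := .defn t S)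
  | there _ ih => exact .there ih

theorem LookupDef.hasType {Γ : Ctx} {x : ℕ} {t S : Tm} (h : LookupDef Γ x t S) (hΓ : Valid Γ) :
    HasType Γ t S := by
  induction h with
  | here =>
    cases hΓ with
    | defn h₁ h₂ h₃ => exact HasType.wk h₃ (.defn h₁ h₂ h₃)
  | there _ ih => exact (ih hΓ.tail).wk hΓ

theorem EqTm.cumul_le {Γ : Ctx} {S T : Tm} {k m : ℕ} (h : EqTm Γ S T (.set k)) (hkm : k ≤ m) :
    EqTm Γ S T (.set m) := by
  induction hkm with
  | refl => exact h
  | step _ ih => exact .equal_cumul ih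

/-- Instances of a type at equal terms are equal, by `β`. -/
theorem EqTm.inst_congr {Γ : Ctx} {s s' S T : Tm} {k : ℕ} (hS : IsType Γ S)
    (hT : HasType (.decl S :: Γ) T (.set k)) (hs : HasType Γ s S) (hs' : HasType Γ s' S)
    (e : EqTm Γ s s' S) : EqTm Γ (T.inst s) (T.inst s') (.set k) := by
  obtain ⟨m, hS⟩ := hS
  have h : EqTm Γ (.app (.lam S T) s) (.app (.lam S T) s') (.set k) :=
    .app_congr (T := .set k) (.refl (.lam hS hT)) e
  exact .trans (.symm (.beta (T := .set k) hS hT hs)) (.trans h (.beta (T := .set k) hS hT hs'))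

/-- In a congruence rule the right-hand term naturally has its type instantiated at the right-hand
argument, whereas the rule states the left-hand instance; this moves between the two. -/
theorem IsType.conv_inst {Γ : Ctx} {s s' t S T : Tm} (hS : IsType Γ S)
    (hT : IsType (.decl S :: Γ) T) (hs : HasType Γ s S) (hs' : HasType Γ s' S)
    (e : EqTm Γ s s' S) (ht : HasType Γ t (T.inst s)) : HasType Γ t (T.inst s') :=
  have ⟨_, hT⟩ := hT
  .conv ht (hT.inst hs') (EqTm.inst_congr hS hT hs hs' e)

/-- The presuppositions of a judgment. -/
def Judgment.Presupposed : Judgment → Prop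
  | valid _ => True
  | typing Γ _ T => IsType Γ T
  | equal Γ s t T => HasType Γ s T ∧ HasType Γ t T ∧ IsType Γ T
  | label _ _ => True
  | labelEq Γ l m => Derivable (label Γ l) ∧ Derivable (label Γ m)

/-- For typings, the components of a premise's type come from inversion. For equalities, the
right-hand side is first typed at its own natural type and then converted to the type in the rule.
-/
theorem Derivable.presupposed {J : Judgment} (h : Derivable J) : J.Presupposed := by
  induction h with
  | nil | decl | defn | lname | lapp => trivial
  | var hΓ hx => exact hx.isType hΓ
  | conv _ hT _ => exact ⟨_, hT⟩
  | cumul h => exact .set (HasType.valid h) _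
  | set hΓ => exact .set hΓ _
  | pi h => exact .set (HasType.valid h) _
  | sigma h => exact .set (HasType.valid h) _
  | lam hS _ _ ih => exact .pi ⟨_, hS⟩ fun _ => ih
  | app _ hs ih _ => exact .inst hs ih.of_pi.2
  | pair hS _ hT => exact .sigma ⟨_, hS⟩ fun _ => ⟨_, hT⟩
  | fst _ ih => exact ih.of_sigma.1
  | snd h ih => exact .inst (.fst h) ih.of_sigma.2
  | unit hΓ => exact .set hΓ _
  | void hΓ => exact ⟨0, .unit hΓ⟩
  | const hΓ => exact Const.isType_type hΓ _
  | lbl _ h => exact .set (HasType.valid h) _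
  | ret _ hl ih _ =>
    obtain ⟨k, hT⟩ := ih
    exact ⟨k, .lbl hl hT⟩
  | call _ ih => exact ih.of_lbl.2
  | beta hS ht hs _ iht _ =>
    exact ⟨.app (.lam hS ht) hs, HasType.inst ht hs, .inst hs iht⟩
  | fst_pair hS hs hT ht => exact ⟨.fst (.pair hS hs hT ht), hs, ⟨_, hS⟩⟩
  | snd_pair hS hs hT ht =>
    have hp := Derivable.pair hS hs hT ht
    have hT' : IsType _ _ := ⟨_, hT⟩
    have e := Derivable.fst_pair hS hs hT ht
    -- The second projection is typed at the instance by `fst (pair s t T)`; the computation rule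
    -- for `fst` turns this into the instance by `s`.
    exact ⟨IsType.conv_inst ⟨_, hS⟩ hT' (.fst hp) hs e (.snd hp), ht, .inst hs hT'⟩
  | delta hΓ hx => exact ⟨.var hΓ hx.lookup, hx.hasType hΓ, hx.lookup.isType hΓ⟩
  | computes _ hs ht ih => exact ⟨hs, ht, ih⟩
  | call_ret hl ht _ ih => exact ⟨.call (.ret ht hl), ht, ih⟩
  | refl ht ih => exact ⟨ht, ht, ih⟩
  | symm _ ih => exact ⟨ih.2.1, ih.1, ih.2.2⟩
  | trans _ _ ih₁ ih₂ => exact ⟨ih₁.1, ih₂.2.1, ih₁.2.2⟩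
  | equal_conv _ hT e ih => exact ⟨.conv ih.1 hT e, .conv ih.2.1 hT e, ⟨_, hT⟩⟩
  | equal_cumul _ ih => exact ⟨.cumul ih.1, .cumul ih.2.1, .set ih.1.valid _⟩
  | pi_congr hS e _ _ ih₁ ih₂ =>
    exact ⟨.pi hS ih₂.1, .pi ih₁.2.1 (HasType.conv_ctx hS ih₁.2.1 e ih₂.2.1), .set (HasType.valid hS) _⟩
  | sigma_congr hS e _ _ ih₁ ih₂ =>
    exact ⟨.sigma hS ih₂.1, .sigma ih₁.2.1 (HasType.conv_ctx hS ih₁.2.1 e ih₂.2.1),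
      .set (HasType.valid hS) _⟩
  | lam_congr hS e et _ ih₁ ih₂ =>
    have hP := IsType.pi ⟨_, hS⟩ fun _ => ih₂.2.2
    obtain ⟨m, hT⟩ := ih₂.2.2
    -- The right-hand abstraction has the changed domain and must be converted back. Domain and
    -- codomain may live at different levels, so both are raised to the maximum.
    have eP := Derivable.pi_congr (HasType.cumul_le hS (le_max_left _ m))
      (EqTm.cumul_le e (le_max_left _ m)) (.refl (hT.cumul_le (le_max_right _ m)))
    have hP' := Derivable.pi (HasType.cumul_le hS (le_max_left _ m))
      (hT.cumul_le (le_max_right _ m))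
    exact ⟨.lam hS ih₂.1,
      .conv (.lam ih₁.2.1 (HasType.conv_ctx hS ih₁.2.1 e ih₂.2.1)) hP' (.symm eP), hP⟩
  | app_congr _ es ih₁ ih₂ =>
    have hP := ih₁.2.2.of_pi
    exact ⟨.app ih₁.1 ih₂.1,
      IsType.conv_inst hP.1 hP.2 ih₂.2.1 ih₂.1 (.symm es) (.app ih₁.2.1 ih₂.2.1), .inst ih₂.1 hP.2⟩
  | pair_congr hS es eT et _ ihs ihT iht =>
    have hT : IsType _ _ := ⟨_, ihT.1⟩
    have hS' : IsType _ _ := ⟨_, hS⟩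
    -- The second component `t'` needs two conversions: from `T.inst s` to `T.inst s'`, and then
    -- along `T ≡ T'` to `T'.inst s'`.
    have ht' := IsType.conv_inst hS' hT ihs.1 ihs.2.1 es iht.2.1
    have e := Derivable.sigma_congr hS (.refl hS) eT
    exact ⟨.pair hS ihs.1 ihT.1 iht.1,
      .conv (.pair hS ihs.2.1 ihT.2.1
        (.conv ht' (HasType.inst ihT.2.1 ihs.2.1) (EqTm.inst eT ihs.2.1)))
        (.sigma hS ihT.1) (.symm e), .sigma hS' fun _ => hT⟩
  | fst_congr _ ih => exact ⟨.fst ih.1, .fst ih.2.1, ih.2.2.of_sigma.1⟩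
  | snd_congr e ih =>
    have hP := ih.2.2.of_sigma
    exact ⟨.snd ih.1, IsType.conv_inst hP.1 hP.2 (.fst ih.2.1) (.fst ih.1) (.symm (.fst_congr e))
      (.snd ih.2.1), .inst (.fst ih.1) hP.2⟩
  | lname_congr hΓ => exact ⟨.lname hΓ, .lname hΓ⟩
  | lapp_congr _ _ ih₁ ih₂ => exact ⟨.lapp ih₁.1 ih₂.1, .lapp ih₁.2 ih₂.2.1⟩
  | lbl_congr _ _ ih₁ ih₂ =>
    exact ⟨.lbl ih₁.1 ih₂.1, .lbl ih₁.2 ih₂.2.1, .set ih₂.1.valid _⟩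
  | ret_congr _ hl ih =>
    obtain ⟨k, hT⟩ := ih.2.2
    exact ⟨.ret ih.1 hl, .ret ih.2.1 hl, ⟨k, .lbl hl hT⟩⟩
  | call_congr el eT _ ih₁ ih₂ ih₃ =>
    -- On the right, `c'` is moved to the label type of `l'` and `T'` before it is called, and the
    -- result is converted from `T'` back to `T`.
    exact ⟨.call ih₃.1, .conv (.call (.conv ih₃.2.1 (.lbl ih₁.2 ih₂.2.1) (.lbl_congr el eT)))
      ih₂.1 (.symm eT), ⟨_, ih₂.1⟩⟩

theorem HasType.isType {Γ : Ctx} {t T : Tm} (h : HasType Γ t T) : IsType Γ T :=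
  Derivable.presupposed h

/-! ### Typing rules for applied constants -/

set_option linter.unusedSimpArgs false

theorem Tm.wk_subst_single (t s : Tm) : t.wk.subst (single s) = t := wk_inst t s

/-- As in the rules that follow, arguments are supplied one at a time. The simplification after each
one cancels weakening against instantiation, which for an arbitrary argument is a lemma and not a
computation. -/
theorem HasType.consE {Γ : Ctx} {t E : Tm}
    (ht : HasType Γ t (cst .uid []))
    (hE : HasType Γ E (cst .enumU [])) :
    HasType Γ (cst .consE [t, E]) (cst .enumU []) := by
  have h := (Derivable.const (c := .consE) ht.valid).app ht
  simp only [wk_subst_single, wk_subst_liftSub, arrow, cst, apps, List.foldl, Tm.wk, Tm.rename,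
    liftRen, Tm.inst, Tm.subst, single, liftSub] at h
  replace h := h.app hE
  simp only [wk_subst_single, wk_subst_liftSub, arrow, cst, apps, List.foldl, Tm.wk, Tm.rename,
    liftRen, Tm.inst, Tm.subst, single, liftSub] at h
  exact h

theorem HasType.enumT {Γ : Ctx} {E : Tm}
    (hE : HasType Γ E (cst .enumU [])) :
    HasType Γ (cst .enumT [E]) (.set 0) := by
  have h := (Derivable.const (c := .enumT) hE.valid).app hE
  simp only [wk_subst_single, wk_subst_liftSub, arrow, cst, apps, List.foldl, Tm.wk, Tm.rename,
    liftRen, Tm.inst, Tm.subst, single, liftSub] at h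
  exact h

theorem HasType.zeE {Γ : Ctx} {t E : Tm}
    (ht : HasType Γ t (cst .uid []))
    (hE : HasType Γ E (cst .enumU [])) :
    HasType Γ (cst .zeE [t, E]) (cst .enumT [cst .consE [t, E]]) := by
  have h := (Derivable.const (c := .zeE) ht.valid).app ht
  simp only [wk_subst_single, wk_subst_liftSub, arrow, cst, apps, List.foldl, Tm.wk, Tm.rename,
    liftRen, Tm.inst, Tm.subst, single, liftSub] at h
  replace h := h.app hE
  simp only [wk_subst_single, wk_subst_liftSub, arrow, cst, apps, List.foldl, Tm.wk, Tm.rename,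
    liftRen, Tm.inst, Tm.subst, single, liftSub] at h
  exact h

theorem HasType.suE {Γ : Ctx} {t E x : Tm}
    (ht : HasType Γ t (cst .uid []))
    (hE : HasType Γ E (cst .enumU []))
    (hx : HasType Γ x (cst .enumT [E])) :
    HasType Γ (cst .suE [t, E, x]) (cst .enumT [cst .consE [t, E]]) := by
  have h := (Derivable.const (c := .suE) ht.valid).app ht
  simp only [wk_subst_single, wk_subst_liftSub, arrow, cst, apps, List.foldl, Tm.wk, Tm.rename,
    liftRen, Tm.inst, Tm.subst, single, liftSub] at h
  replace h := h.app hE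
  simp only [wk_subst_single, wk_subst_liftSub, arrow, cst, apps, List.foldl, Tm.wk, Tm.rename,
    liftRen, Tm.inst, Tm.subst, single, liftSub] at h
  replace h := h.app hx
  simp only [wk_subst_single, wk_subst_liftSub, arrow, cst, apps, List.foldl, Tm.wk, Tm.rename,
    liftRen, Tm.inst, Tm.subst, single, liftSub] at h
  exact h

theorem HasType.spi {Γ : Ctx} {E P : Tm} {k : ℕ}
    (hE : HasType Γ E (cst .enumU []))
    (hP : HasType Γ P (arrow (cst .enumT [E]) (.set k))) :
    HasType Γ (cst (.spi k) [E, P]) (.set k) := by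
  have h := (Derivable.const (c := .spi k) hE.valid).app hE
  simp only [wk_subst_single, wk_subst_liftSub, arrow, cst, apps, List.foldl, Tm.wk, Tm.rename,
    liftRen, Tm.inst, Tm.subst, single, liftSub] at h
  replace h := h.app hP
  simp only [wk_subst_single, wk_subst_liftSub, arrow, cst, apps, List.foldl, Tm.wk, Tm.rename,
    liftRen, Tm.inst, Tm.subst, single, liftSub] at h
  exact h

theorem HasType.switch {Γ : Ctx} {E P b : Tm} {k : ℕ}
    (hE : HasType Γ E (cst .enumU []))
    (hP : HasType Γ P (arrow (cst .enumT [E]) (.set k)))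
    (hb : HasType Γ b (cst (.spi k) [E, P])) :
    HasType Γ (cst (.switch k) [E, P, b]) (.pi (cst .enumT [E]) (.app P.wk (.var 0))) := by
  have h := (Derivable.const (c := .switch k) hE.valid).app hE
  simp only [wk_subst_single, wk_subst_liftSub, arrow, cst, apps, List.foldl, Tm.wk, Tm.rename,
    liftRen, Tm.inst, Tm.subst, single, liftSub] at h
  replace h := h.app hP
  simp only [wk_subst_single, wk_subst_liftSub, arrow, cst, apps, List.foldl, Tm.wk, Tm.rename,
    liftRen, Tm.inst, Tm.subst, single, liftSub] at h
  replace h := h.app hb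
  simp only [wk_subst_single, wk_subst_liftSub, arrow, cst, apps, List.foldl, Tm.wk, Tm.rename,
    liftRen, Tm.inst, Tm.subst, single, liftSub] at h
  exact h

theorem HasType.mu {Γ : Ctx} {D : Tm} {k : ℕ}
    (hD : HasType Γ D (cst (.desc k) [])) :
    HasType Γ (cst (.mu k) [D]) (.set k) := by
  have h := (Derivable.const (c := .mu k) hD.valid).app hD
  simp only [wk_subst_single, wk_subst_liftSub, arrow, cst, apps, List.foldl, Tm.wk, Tm.rename,
    liftRen, Tm.inst, Tm.subst, single, liftSub] at h
  exact h

theorem HasType.interp {Γ : Ctx} {D X : Tm} {k : ℕ}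
    (hD : HasType Γ D (cst (.desc k) []))
    (hX : HasType Γ X (.set k)) :
    HasType Γ (cst (.interp k) [D, X]) (.set k) := by
  have h := (Derivable.const (c := .interp k) hD.valid).app hD
  simp only [wk_subst_single, wk_subst_liftSub, arrow, cst, apps, List.foldl, Tm.wk, Tm.rename,
    liftRen, Tm.inst, Tm.subst, single, liftSub] at h
  replace h := h.app hX
  simp only [wk_subst_single, wk_subst_liftSub, arrow, cst, apps, List.foldl, Tm.wk, Tm.rename,
    liftRen, Tm.inst, Tm.subst, single, liftSub] at h
  exact h

theorem HasType.con {Γ : Ctx} {D x : Tm} {k : ℕ}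
    (hD : HasType Γ D (cst (.desc k) []))
    (hx : HasType Γ x (cst (.interp k) [D, cst (.mu k) [D]])) :
    HasType Γ (cst (.con k) [D, x]) (cst (.mu k) [D]) := by
  have h := (Derivable.const (c := .con k) hD.valid).app hD
  simp only [wk_subst_single, wk_subst_liftSub, arrow, cst, apps, List.foldl, Tm.wk, Tm.rename,
    liftRen, Tm.inst, Tm.subst, single, liftSub] at h
  replace h := h.app hx
  simp only [wk_subst_single, wk_subst_liftSub, arrow, cst, apps, List.foldl, Tm.wk, Tm.rename,
    liftRen, Tm.inst, Tm.subst, single, liftSub] at h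
  exact h

/-- The index is left out because `iInterp` takes the whole family as its argument. -/
theorem HasType.imu {Γ : Ctx} {I R : Tm} {k : ℕ}
    (hI : HasType Γ I (.set k))
    (hR : HasType Γ R (arrow I (cst (.idesc k) [I]))) :
    HasType Γ (cst (.imu k) [I, R]) (arrow I (.set k)) := by
  have h := (Derivable.const (c := .imu k) hI.valid).app hI
  simp only [wk_subst_single, wk_subst_liftSub, arrow, cst, apps, List.foldl, Tm.wk, Tm.rename,
    liftRen, Tm.inst, Tm.subst, single, liftSub] at h
  replace h := h.app hR
  simp only [wk_subst_single, wk_subst_liftSub, arrow, cst, apps, List.foldl, Tm.wk, Tm.rename,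
    liftRen, Tm.inst, Tm.subst, single, liftSub] at h
  exact h

theorem HasType.iInterp {Γ : Ctx} {I D X : Tm} {k : ℕ}
    (hI : HasType Γ I (.set k))
    (hD : HasType Γ D (cst (.idesc k) [I]))
    (hX : HasType Γ X (arrow I (.set k))) :
    HasType Γ (cst (.iInterp k) [I, D, X]) (.set k) := by
  have h := (Derivable.const (c := .iInterp k) hI.valid).app hI
  simp only [wk_subst_single, wk_subst_liftSub, arrow, cst, apps, List.foldl, Tm.wk, Tm.rename,
    liftRen, Tm.inst, Tm.subst, single, liftSub] at h
  replace h := h.app hD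
  simp only [wk_subst_single, wk_subst_liftSub, arrow, cst, apps, List.foldl, Tm.wk, Tm.rename,
    liftRen, Tm.inst, Tm.subst, single, liftSub] at h
  replace h := h.app hX
  simp only [wk_subst_single, wk_subst_liftSub, arrow, cst, apps, List.foldl, Tm.wk, Tm.rename,
    liftRen, Tm.inst, Tm.subst, single, liftSub] at h
  exact h

theorem HasType.icon {Γ : Ctx} {I R i x : Tm} {k : ℕ}
    (hI : HasType Γ I (.set k))
    (hR : HasType Γ R (arrow I (cst (.idesc k) [I])))
    (hi : HasType Γ i I)
    (hx : HasType Γ x (cst (.iInterp k) [I, .app R i, cst (.imu k) [I, R]])) :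
    HasType Γ (cst (.icon k) [I, R, i, x]) (cst (.imu k) [I, R, i]) := by
  have h := (Derivable.const (c := .icon k) hI.valid).app hI
  simp only [wk_subst_single, wk_subst_liftSub, arrow, cst, apps, List.foldl, Tm.wk, Tm.rename,
    liftRen, Tm.inst, Tm.subst, single, liftSub] at h
  replace h := h.app hR
  simp only [wk_subst_single, wk_subst_liftSub, arrow, cst, apps, List.foldl, Tm.wk, Tm.rename,
    liftRen, Tm.inst, Tm.subst, single, liftSub] at h
  replace h := h.app hi
  simp only [wk_subst_single, wk_subst_liftSub, arrow, cst, apps, List.foldl, Tm.wk, Tm.rename,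
    liftRen, Tm.inst, Tm.subst, single, liftSub] at h
  replace h := h.app hx
  simp only [wk_subst_single, wk_subst_liftSub, arrow, cst, apps, List.foldl, Tm.wk, Tm.rename,
    liftRen, Tm.inst, Tm.subst, single, liftSub] at h
  exact h

/-! ### Soundness of the elaboration of terms -/

/-- The context of an elaboration judgment. -/
def ElabJudgment.ctx : ElabJudgment → Ctx
  | synth Γ _ _ _ => Γ
  | check Γ _ _ _ => Γ
  | label Γ _ _ => Γ

/-- Terms are elaborated in valid contexts. -/
theorem Elab.valid_ctx {J : ElabJudgment} (h : Elab J) : Valid J.ctx := by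
  induction h with
  | lam _ ih => exact ih.tail
  | iinn h => exact HasType.valid h
  | tag_ze h => exact HasType.valid h
  | _ => assumption

/-- The soundness of an elaboration judgment; type checking presupposes a type. -/
def ElabJudgment.Sound : ElabJudgment → Prop
  | synth Γ _ t T => HasType Γ t T
  | check Γ T _ t => IsType Γ T → HasType Γ t T
  | label Γ _ l => Derivable (.label Γ l)

/-- Regularity of the equation supplies the premise of conversion that the target is a type. -/
theorem HasType.conv_of_eqTm {Γ : Ctx} {S T t : Tm} {k : ℕ} (e : EqTm Γ S T (.set k))
    (ht : HasType Γ t S) : HasType Γ t T :=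
  .conv ht (Derivable.presupposed e).2.1 e

/-- Synthesis needs no assumption, since regularity makes its output a type. In checking, each case
must show that the targets of its premises are types, by inverting its own target or by typing them
from side conditions and earlier premises. -/
theorem Elab.sound {J : ElabJudgment} (h : Elab J) : J.Sound := by
  induction h with
  | var hΓ hx => exact .var hΓ hx
  | const hΓ => exact .const hΓ
  | ann h _ ihS ihs => exact ihs ⟨_, ihS (.set h.valid_ctx _)⟩
  -- The argument is checked against the domain of a synthesised function type, which regularity and
  -- inversion show to be a type.
  | app _ _ ihf ihs => exact .app ihf (ihs (HasType.isType ihf).of_pi.1)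
  | fst _ ih => exact .fst ih
  | snd _ ih => exact .snd ih
  | call _ ih => exact .call ih
  | switch _ e ih => exact fun _ => HasType.conv_of_eqTm e ih
  | conv hS e _ ih => exact fun _ => HasType.conv_of_eqTm e (ih ⟨_, hS⟩)
  | set hΓ => exact fun _ => .set hΓ
  | cumul h ih => exact fun _ => .cumul (ih (.set h.valid_ctx _))
  | pi _ h ihS ihT => exact fun hU => .pi (ihS hU) (ihT (.set h.valid_ctx _))
  | sigma _ h ihS ihT => exact fun hU => .sigma (ihS hU) (ihT (.set h.valid_ctx _))
  | unit hΓ => exact fun _ => HasType.cumul_le (.unit hΓ) (Nat.zero_le _)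
  | lam _ ih =>
    intro hP
    obtain ⟨⟨_, hS⟩, hT⟩ := hP.of_pi
    exact .lam hS (ih hT)
  | nil hΓ => exact fun _ => .void hΓ
  | cons _ _ ihx ihxs =>
    intro hP
    obtain ⟨hA, hB⟩ := hP.of_sigma
    exact .pair' rfl hA (fun _ => hB) (ihx hA) rfl (ihxs (.inst (ihx hA) hB))
  | tag_uid hΓ | enum_nil hΓ => exact fun _ => .const hΓ
  | enum_cons h ih => exact fun hU => .consE (.const h.valid_ctx) (ih hU)
  | cases h hP _ ihE ihes =>
    have hE := ihE ⟨0, .const h.valid_ctx⟩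
    exact fun _ => .switch hE hP (ihes ⟨_, .spi hE hP⟩)
  | tag_ze hE => exact fun _ => .zeE (.const (HasType.valid hE)) hE
  | tag_su hE _ ih => exact fun _ => .suE (.const (HasType.valid hE)) hE (ih ⟨0, .enumT hE⟩)
  | inn hD _ ih => exact fun _ => .con hD (ih ⟨_, .interp hD (.mu hD)⟩)
  | iinn hI hR hi _ ih =>
    have hRi := HasType.app' hR hi (wk_inst _ _)
    exact fun _ => .icon hI hR hi (ih ⟨_, .iInterp hI hRi (.imu hI hR)⟩)
  -- A constructor elaborates exactly as the corresponding `in` of a tagged tuple, at the same type.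
  | constr _ ih => exact ih
  | iconstr _ _ ih => exact ih
  | lbl _ _ ihl ihT => exact fun hU => .lbl ihl (ihT hU)
  | ret _ ih =>
    intro hU
    -- The elaboration rule never inspects the label; its well-formedness comes from the target.
    obtain ⟨hl, hT⟩ := hU.of_lbl
    exact .ret (ih hT) hl
  | lname hΓ => exact .lname hΓ
  | lapp _ _ ihl ih => exact .lapp ihl ih

/-! ### Soundness of the elaboration of programs -/

theorem IsType.of_piTele {Γ : Ctx} {Xs : Tele} {T : Tm} (h : IsType Γ (piTele Xs T)) :
    IsType (Γ.extend Xs) T := by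
  induction Xs generalizing Γ with
  | nil => exact h
  | cons X Xs ih => exact ih h.of_pi.2

theorem HasType.lamTele {Γ : Ctx} {Xs : Tele} {t T : Tm} (hP : IsType Γ (piTele Xs T))
    (ht : HasType (Γ.extend Xs) t T) : HasType Γ (lamTele Xs t) (piTele Xs T) := by
  induction Xs generalizing Γ with
  | nil => exact ht
  | cons X Xs ih =>
    obtain ⟨⟨_, hX⟩, hT⟩ := IsType.of_pi hP
    exact .lam hX (ih hT ht)

/-- Each argument may assume that its own type is well formed: regularity of the function at that
stage, with inversion, provides this. As the arrows are non-dependent, supplying an argument leaves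
the later types unchanged. -/
theorem HasType.apps_of_arrows {Γ : Ctx} {n : ℕ} {M m : Fin n → Tm} {e T : Tm}
    (he : HasType Γ e (arrows (List.ofFn M) T))
    (hm : ∀ i, IsType Γ (M i) → HasType Γ (m i) (M i)) :
    HasType Γ (apps e (List.ofFn m)) T := by
  induction n generalizing e with
  | zero => exact he
  | succ n ih =>
    rw [List.ofFn_succ] at he ⊢
    have hM := he.isType.of_pi.1
    have := he.app' (hm 0 hM) (wk_inst _ _)
    exact ih this fun i => hm i.succ

/-- For `return`, inverting the label type gives both the label and the type to check against. For
`by`, the label types of the subprograms are well formed because they occur in the type of a typed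
elimination form. -/
theorem ElabProg.sound {Match : Tm → ExtTm → Prop} {EWM : Ctx → ExtTm → Tm → Tm → Prop}
    (hEWM : ∀ Γ e e' T, EWM Γ e e' T → HasType Γ e' T) {Γ : Ctx} {p : Prog} {l T t : Tm}
    (h : ElabProg Match EWM Γ p l T t) (hT : IsType Γ (.lbl l T)) : HasType Γ t (.lbl l T) := by
  induction h with
  | ret _ he =>
    obtain ⟨hl, hT⟩ := hT.of_lbl
    exact .ret (he.sound hT) hl
  | _ =>
    rename_i _ he _ ih
    -- Peeling the telescope off `hP` makes the label type of each subprogram a type in its extended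
    -- context, as the induction hypothesis requires.
    exact (hEWM _ _ _ _ he).apps_of_arrows fun i hP => .lamTele hP (ih i hP.of_piTele)

/-- A label may be applied to a term of any type, so it suffices that every variable occurring in it
is in range. -/
theorem Derivable.label_labelVars {Γ : Ctx} (hΓ : Valid Γ) (f : String) {n : ℕ}
    (hn : n ≤ Γ.length) : Derivable (.label Γ (labelVars f n)) := by
  have hx : ∀ {Γ : Ctx} {x}, x < Γ.length → ∃ S, Lookup Γ x S := by
    intro Γ x h
    induction Γ generalizing x with
    | nil => exact absurd h (Nat.not_lt_zero _)
    | cons e Γ ih =>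
      cases x with
      | zero => exact ⟨_, .here⟩
      | succ x =>
        obtain ⟨S, hS⟩ := ih (Nat.lt_of_succ_lt_succ h)
        exact ⟨_, .there hS⟩
  have hl : ∀ (xs : List ℕ) {l}, (∀ x ∈ xs, x < Γ.length) → Derivable (.label Γ l) →
      Derivable (.label Γ ((xs.map Tm.var).foldl Tm.lapp l)) := by
    intro xs
    induction xs with
    | nil => exact fun _ h => h
    | cons x xs ih =>
      intro l hxs h
      obtain ⟨S, hS⟩ := hx (hxs x (by simp))
      exact ih (fun y hy => hxs y (by simp [hy])) (.lapp h (.var hΓ hS))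
  exact hl _ (fun x hx => (List.mem_range.1 (List.mem_reverse.1 hx)).trans_le hn) (.lname hΓ)

theorem Ctx.length_extend (Γ : Ctx) (Xs : Tele) : (Γ.extend Xs).length = Γ.length + Xs.length := by
  induction Xs generalizing Γ with
  | nil => rfl
  | cons X Xs ih =>
    rw [Ctx.extend, ih, List.length_cons, List.length_cons]
    omega

end LabelTT

theorem mainTheorem5
    (Match : LabelTT.Tm → LabelTT.ExtTm → Prop)
    (EWM : LabelTT.Ctx → LabelTT.ExtTm → LabelTT.Tm → LabelTT.Tm → Prop)
    (hEWM : ∀ Γ e e' T, EWM Γ e e' T → LabelTT.HasType Γ e' T)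
    (Γ Δ : LabelTT.Ctx) (f : String) (X : List LabelTT.ExtTm) (T : LabelTT.ExtTm)
    (t : LabelTT.Prog) (h : LabelTT.ElabLet Match EWM Γ f X T t Δ) :
    LabelTT.Valid Δ := by
  obtain ⟨-, hP, ht⟩ := h
  have hΓ := hP.valid_ctx
  have hP' := hP.sound (.set hΓ _)
  have hT := LabelTT.IsType.of_piTele ⟨_, hP'⟩
  -- The arguments of the label are the variables of the telescope just added, so they are in range
  -- in the extended context.
  have hl := LabelTT.Derivable.label_labelVars hT.choose_spec.valid f
    ((Nat.le_add_left _ _).trans_eq (LabelTT.Ctx.length_extend Γ _).symm)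
  have ht' := ht.sound hEWM ⟨_, .lbl hl hT.choose_spec⟩
  -- `call` turns the label type of the body into the declared result type, and abstraction over the
  -- telescope gives the type of the definition.
  exact .defn hΓ hP' (LabelTT.HasType.lamTele ⟨_, hP'⟩ (.call ht'))
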